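/- Let $n\ge 2$ and let $\mathcal P_n$ be the partition monoid of degree $n$: its elements are the set partitions of $[n]\cup[n]'$, where $[n]=\{1,\dots,n\}$ and $[n]'=\{1',\dots,n'\}$ is a disjoint copy. The product $ab$ is obtained by identifying the lower row of $a$ with the upper row of $b$; two elements of $[n]\cup[n]'$ lie in the same block of $ab$ if and only if they are in the same connected component of the resulting graph on three rows. The involution $a\mapsto a^*$ interchanges $i$ and $i'$ for all $i$. The rank of $a$ is the number of blocks that meet both $[n]$ and $[n]'$. A projection is an element $p$ with $p^2=p=p^*$; let $P=\mathsf P(\mathcal P_n)$ be the set of projections, with the operations $q\mapsto pqp$ ($p\in P$). Let $\mathsf{PG}(P)$ be the semigroup defined by the presentation \[ \bigl\langle x_p\ (p\in P)\ \big|\ x_p^2=x_p,\ (x_px_q)^2=x_px_q,\ x_px_qx_p=x_{pqp}\ (p,q\in P)\bigr\rangle , \] the free projection-generated regular $*$-semigroup over $P$, and let $\pi\colon\mathsf{PG}(P)\to\mathcal P_n$ be the homomorphism with $x_p\mapsto p$. The maximal subgroup of a semigroup containing an idempotent $e$ is the $\mathscr H$-class of $e$. Let $0\le r\le n-2$. Then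 for every projection $p\in P$ of rank $r$ the maximal subgroup of $\mathsf{PG}(P)$ containing $x_p$ is isomorphic to the symmetric group $S_r$. More generally, for every idempotent $e\in\mathcal P_n$ of rank $r$ there is exactly one idempotent $f$ of $\mathsf{PG}(P)$ with $\pi(f)=e$, and the maximal subgroup of $\mathsf{PG}(P)$ containing this $f$ is isomorphic to $S_r$. -/

import Mathlib

/-! ### Regular `*`-semigroups and their projections -/

/-- A regular `*`-semigroup: `a** = a = a a* a` and `(ab)* = b* a*`. -/
class RegularStarSemigroup (S : Type*) [Semigroup S] extends StarMul S where
  mul_star_mul_self : ∀ a : S, a * star a * a = a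

/-- The set `P(S)` of projections of `S`, i.e. of the idempotents `p` with `p* = p`. -/
abbrev Projections (S : Type*) [Semigroup S] [RegularStarSemigroup S] : Type _ :=
  {p : S // IsStarProjection p}

namespace Projections

variable {S : Type*} [Semigroup S] [RegularStarSemigroup S]

theorem mul_mul_mul (p q : Projections S) : (p * q * (p * q) : S) = p * q := by
  have h := RegularStarSemigroup.mul_star_mul_self (p * q : S)
  rw [star_mul, p.2.isSelfAdjoint.star_eq, q.2.isSelfAdjoint.star_eq] at h
  calc (p * q * (p * q) : S) = p * (q * q) * (p * p) * q := by
        rw [q.2.isIdempotentElem.eq, p.2.isIdempotentElem.eq]; simp only [mul_assoc]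
    _ = p * q * (q * p) * (p * q) := by simp only [mul_assoc]
    _ = p * q := h

/-- The projection algebra operations `θ_p : q ↦ pqp`. -/
def theta (p q : Projections S) : Projections S :=
  ⟨p * q * p, by
    constructor
    · change (p * q * p * (p * q * p) : S) = p * q * p
      calc (p * q * p * (p * q * p) : S) = p * q * (p * p) * q * p := by simp only [mul_assoc]
        _ = (p * q * (p * q)) * p := by rw [p.2.isIdempotentElem.eq]; simp only [mul_assoc]
        _ = p * q * p := by rw [mul_mul_mul]
    · change star (p * q * p : S) = p * q * p
      rw [star_mul, star_mul, p.2.isSelfAdjoint.star_eq, q.2.isSelfAdjoint.star_eq, mul_assoc]⟩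

end Projections

/-! ### The free projection-generated regular `*`-semigroup -/

/-- The defining relations `x_p² = x_p`, `(x_p x_q)² = x_p x_q`, `x_p x_q x_p = x_{pqp}`. -/
inductive PGRel (S : Type*) [Semigroup S] [RegularStarSemigroup S] :
    FreeSemigroup (Projections S) → FreeSemigroup (Projections S) → Prop
  | idem (p : Projections S) :
      PGRel S (FreeSemigroup.of p * FreeSemigroup.of p) (FreeSemigroup.of p)
  | mul_idem (p q : Projections S) :
      PGRel S ((FreeSemigroup.of p * FreeSemigroup.of q) * (FreeSemigroup.of p * FreeSemigroup.of q))
        (FreeSemigroup.of p * FreeSemigroup.of q)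
  | theta (p q : Projections S) :
      PGRel S (FreeSemigroup.of p * FreeSemigroup.of q * FreeSemigroup.of p)
        (FreeSemigroup.of (p.theta q))

/-- `PG(P(S))`: the semigroup presented by the generators `x_p` (`p ∈ P(S)`) and the relations
`PGRel`. It depends only on the projection algebra `(P(S), θ)`. -/
abbrev PG (S : Type*) [Semigroup S] [RegularStarSemigroup S] : Type _ :=
  (conGen (PGRel S)).Quotient

namespace PG

variable {S : Type*} [Semigroup S] [RegularStarSemigroup S]

/-- The generator `x_p`. -/
def x (p : Projections S) : PG S := ((FreeSemigroup.of p : FreeSemigroup (Projections S)) : PG S)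

theorem isIdempotentElem_x (p : Projections S) : IsIdempotentElem (x p) :=
  (Con.eq _).2 (ConGen.Rel.of _ _ (PGRel.idem p))

theorem conGen_le_ker :
    conGen (PGRel S) ≤ Con.ker (FreeSemigroup.lift (fun p : Projections S => (p : S))) := by
  refine Con.conGen_le.2 ?_
  intro u v h
  rw [Con.ker_rel]
  cases h with
  | idem p => simpa using p.2.isIdempotentElem.eq
  | mul_idem p q => simpa using Projections.mul_mul_mul p q
  | theta p q => simp [Projections.theta]

/-- The canonical homomorphism `π : PG(P(S)) → S` with `x_p ↦ p`. -/
def toSemigroup (S : Type*) [Semigroup S] [RegularStarSemigroup S] : PG S →ₙ* S where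
  toFun w := Con.liftOn w (FreeSemigroup.lift (fun p : Projections S => (p : S)))
    fun _ _ h => conGen_le_ker h
  map_mul' u v := Con.induction_on₂ u v fun a b =>
    map_mul (FreeSemigroup.lift (fun p : Projections S => (p : S))) a b

theorem toSemigroup_x (p : Projections S) : toSemigroup S (x p) = p := rfl

end PG

/-! ### Green's relations and maximal subgroups -/

section Green

variable {S : Type*} [Semigroup S]

/-- `a ≤_R b`, i.e. `a S¹ ⊆ b S¹`, i.e. `a ∈ b S¹`. -/
def GreenRLe (a b : S) : Prop := a = b ∨ ∃ s, a = b * s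

/-- `a ≤_L b`, i.e. `S¹ a ⊆ S¹ b`, i.e. `a ∈ S¹ b`. -/
def GreenLLe (a b : S) : Prop := a = b ∨ ∃ s, a = s * b

/-- Green's relation `R`. -/
def GreenR (a b : S) : Prop := GreenRLe a b ∧ GreenRLe b a

/-- Green's relation `L`. -/
def GreenL (a b : S) : Prop := GreenLLe a b ∧ GreenLLe b a

/-- Green's relation `H = L ∩ R`. -/
def GreenH (a b : S) : Prop := GreenL a b ∧ GreenR a b

theorem GreenRLe.mul_eq {a e : S} (he : IsIdempotentElem e) (h : GreenRLe a e) : e * a = a := by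
  rcases h with rfl | ⟨s, rfl⟩
  · exact he
  · rw [← mul_assoc, he.eq]

theorem GreenLLe.mul_eq {a e : S} (he : IsIdempotentElem e) (h : GreenLLe a e) : a * e = a := by
  rcases h with rfl | ⟨s, rfl⟩
  · exact he
  · rw [mul_assoc, he.eq]

/-- The maximal subgroup of `S` containing the idempotent `e`: the `H`-class of `e`, with the
multiplication of `S`. -/
def maximalSubgroup (e : S) (he : IsIdempotentElem e) : Subsemigroup S where
  carrier := {a | GreenH a e}
  mul_mem' := by
    rintro a b ⟨⟨ha, ha'⟩, ⟨ha1, ha1'⟩⟩ ⟨⟨hb, hb'⟩, ⟨hb1, hb1'⟩⟩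
    have e1 := ha.mul_eq he
    have e2 := hb1.mul_eq he
    have aux : ∀ c : S, GreenRLe e c → ∃ s, e = c * s := by
      rintro c (rfl | h)
      · exact ⟨_, he.symm⟩
      · exact h
    have aux' : ∀ c : S, GreenLLe e c → ∃ s, e = s * c := by
      rintro c (rfl | h)
      · exact ⟨_, he.symm⟩
      · exact h
    obtain ⟨s, hs⟩ := aux a ha1'
    obtain ⟨t, ht⟩ := aux b hb1'
    obtain ⟨s', hs'⟩ := aux' a ha'
    obtain ⟨t', ht'⟩ := aux' b hb'
    refine ⟨⟨Or.inr ⟨a * b, ?_⟩, Or.inr ⟨t' * s', ?_⟩⟩, ⟨Or.inr ⟨a * b, ?_⟩, Or.inr ⟨t * s, ?_⟩⟩⟩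
    · rw [mul_assoc, hb.mul_eq he]
    · calc e = t' * (e * b) := by rw [e2, ← ht']
        _ = t' * s' * (a * b) := by rw [hs']; simp only [mul_assoc]
    · rw [← mul_assoc, ha1.mul_eq he]
    · calc e = a * e * s := by rw [e1, ← hs]
        _ = a * b * (t * s) := by rw [ht]; simp only [mul_assoc]

end Green

/-! ### The partition monoid -/

/-- The partition monoid over `X`: set partitions of `X ∪ X'`, encoded as equivalence relations on
`X ⊕ X`, where `Sum.inl x` is the upper vertex `x` and `Sum.inr x` is the lower vertex `x'`. -/
@[ext]
structure PartitionMonoid (X : Type*) where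
  rel : Setoid (X ⊕ X)

namespace PartitionMonoid

variable {X : Type*}

/-- The vertices of the product graph: upper row `X`, middle row `X''`, lower row `X'`. -/
inductive Vertex (X : Type*)
  | upper (x : X)
  | middle (x : X)
  | lower (x : X)

/-- Relabelling that changes the lower vertices `x'` to `x''`. -/
def toUpperHalf : X ⊕ X → Vertex X := Sum.elim Vertex.upper Vertex.middle

/-- Relabelling that changes the upper vertices `x` to `x''`. -/
def toLowerHalf : X ⊕ X → Vertex X := Sum.elim Vertex.middle Vertex.lower

/-- The inclusion of `X ∪ X'` in the vertex set of the product graph. -/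
def outer : X ⊕ X → Vertex X := Sum.elim Vertex.upper Vertex.lower

/-- Adjacency in the product graph of `a` and `b`. -/
inductive ProductGraph (a b : PartitionMonoid X) : Vertex X → Vertex X → Prop
  | left {u v : X ⊕ X} (h : a.rel u v) : ProductGraph a b (toUpperHalf u) (toUpperHalf v)
  | right {u v : X ⊕ X} (h : b.rel u v) : ProductGraph a b (toLowerHalf u) (toLowerHalf v)

/-- `u, v ∈ X ∪ X'` are in the same block of `ab` if and only if they are in the same connected
component of the product graph. -/
instance : Mul (PartitionMonoid X) where
  mul a b := ⟨Setoid.comap outer (Relation.EqvGen.setoid (ProductGraph a b))⟩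

theorem mul_rel (a b : PartitionMonoid X) (u v : X ⊕ X) :
    (a * b).rel u v ↔ Relation.EqvGen (ProductGraph a b) (outer u) (outer v) := Iff.rfl

/-- The involution: swap the upper and the lower vertices. -/
instance : Star (PartitionMonoid X) where
  star a := ⟨Setoid.comap Sum.swap a.rel⟩

/-- The two-colourings of the upper and lower rows that are constant on the blocks of `a`
(an auxiliary notion, for the proof of the laws of the multiplication). -/
def Compat (a : PartitionMonoid X) (f g : X → Prop) : Prop :=
  ∀ u v, a.rel u v → Sum.elim f g u = Sum.elim f g v

theorem ext_compat {a b : PartitionMonoid X} (h : ∀ f g, Compat a f g ↔ Compat b f g) : a = b := by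
  have key : ∀ (a b : PartitionMonoid X), (∀ f g, Compat b f g → Compat a f g) →
      ∀ u v, a.rel u v → b.rel u v := by
    intro a b h u v huv
    have hb : Compat b (fun x => b.rel u (Sum.inl x)) (fun x => b.rel u (Sum.inr x)) := by
      intro s t hst
      have e : ∀ w, Sum.elim (fun x => b.rel u (Sum.inl x)) (fun x => b.rel u (Sum.inr x)) w
          = b.rel u w := by rintro (w | w) <;> rfl
      rw [e, e]
      exact propext ⟨fun k => b.rel.trans' k hst, fun k => b.rel.trans' k (b.rel.symm' hst)⟩
    have := h _ _ hb u v huv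
    have e : ∀ w, Sum.elim (fun x => b.rel u (Sum.inl x)) (fun x => b.rel u (Sum.inr x)) w
          = b.rel u w := by rintro (w | w) <;> rfl
    rw [e, e] at this
    exact this ▸ b.rel.refl' u
  ext u v
  exact ⟨key a b (fun f g => (h f g).2) u v, key b a (fun f g => (h f g).1) u v⟩

theorem compat_mul (a b : PartitionMonoid X) (f g : X → Prop) :
    Compat (a * b) f g ↔ ∃ k, Compat a f k ∧ Compat b k g := by
  constructor
  · intro h
    let F : Vertex X → Prop := fun w =>
      ∃ u, Relation.EqvGen (ProductGraph a b) w (outer u) ∧ Sum.elim f g u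
    have hF : ∀ w w', ProductGraph a b w w' → F w = F w' := fun w w' hw => propext
      ⟨fun ⟨u, hu, hu'⟩ => ⟨u, .trans _ _ _ (.symm _ _ (.rel _ _ hw)) hu, hu'⟩,
        fun ⟨u, hu, hu'⟩ => ⟨u, .trans _ _ _ (.rel _ _ hw) hu, hu'⟩⟩
    have hO : ∀ u, F (outer u) = Sum.elim f g u := fun u => propext
      ⟨fun ⟨v, hv, hv'⟩ => (h u v hv) ▸ hv', fun hu => ⟨u, .refl _, hu⟩⟩
    have hf : ∀ x, F (.upper x) = f x := fun x => hO (.inl x)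
    have hg : ∀ x, F (.lower x) = g x := fun x => hO (.inr x)
    refine ⟨fun x => F (.middle x), ?_, ?_⟩
    · intro u v huv
      have := hF _ _ (ProductGraph.left (b := b) huv)
      rcases u with u | u <;> rcases v with v | v <;>
        simpa [toUpperHalf, hf] using this
    · intro u v huv
      have := hF _ _ (ProductGraph.right (a := a) huv)
      rcases u with u | u <;> rcases v with v | v <;>
        simpa [toLowerHalf, hg] using this
  · rintro ⟨k, ha, hb⟩
    let F : Vertex X → Prop := fun w => match w with
      | .upper x => f x
      | .middle x => k x
      | .lower x => g x
    have e1 : ∀ u, F (toUpperHalf u) = Sum.elim f k u := by rintro (u | u) <;> rfl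
    have e2 : ∀ u, F (toLowerHalf u) = Sum.elim k g u := by rintro (u | u) <;> rfl
    have e3 : ∀ u, F (outer u) = Sum.elim f g u := by rintro (u | u) <;> rfl
    have hF : ∀ w w', Relation.EqvGen (ProductGraph a b) w w' → F w = F w' := by
      intro w w' h
      induction h with
      | rel _ _ h =>
        cases h with
        | left h => rw [e1, e1]; exact ha _ _ h
        | right h => rw [e2, e2]; exact hb _ _ h
      | refl => rfl
      | symm _ _ _ ih => exact ih.symm
      | trans _ _ _ _ _ ih1 ih2 => exact ih1.trans ih2
    intro u v huv
    rw [← e3, ← e3]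
    exact hF _ _ huv

theorem compat_star (a : PartitionMonoid X) (f g : X → Prop) :
    Compat (star a) f g ↔ Compat a g f := by
  have e : ∀ (f g : X → Prop) u, Sum.elim f g u.swap = Sum.elim g f u := by
    rintro f g (u | u) <;> rfl
  constructor
  · intro h u v huv
    rw [← e f g u, ← e f g v]
    refine h _ _ ?_
    change a.rel u.swap.swap v.swap.swap
    simpa using huv
  · intro h u v huv
    rw [← e g f u, ← e g f v]
    exact h _ _ huv

instance : Semigroup (PartitionMonoid X) where
  mul_assoc a b c := ext_compat fun f g => by
    simp only [compat_mul]
    exact ⟨fun ⟨k, ⟨l, h1, h2⟩, h3⟩ => ⟨l, h1, k, h2, h3⟩,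
      fun ⟨l, h1, k, h2, h3⟩ => ⟨k, ⟨l, h1, h2⟩, h3⟩⟩

instance : RegularStarSemigroup (PartitionMonoid X) where
  star_involutive a := ext_compat fun f g => by simp only [compat_star]
  star_mul a b := ext_compat fun f g => by
    simp only [compat_star, compat_mul]
    exact ⟨fun ⟨k, h1, h2⟩ => ⟨k, h2, h1⟩, fun ⟨k, h1, h2⟩ => ⟨k, h2, h1⟩⟩
  mul_star_mul_self a := ext_compat fun f g => by
    simp only [compat_star, compat_mul]
    constructor
    · rintro ⟨k, ⟨l, h1, h2⟩, h3⟩ u v huv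
      have e1 := h1 u v huv
      have e2 := h2 u v huv
      have e3 := h3 u v huv
      rcases u with u | u <;> rcases v with v | v <;> simp_all
    · exact fun h => ⟨f, ⟨g, h, h⟩, h⟩

/-- The rank: the number of transversals, i.e. of blocks that meet both rows. -/
noncomputable def rank (a : PartitionMonoid X) : ℕ :=
  {B ∈ a.rel.classes | (∃ x, Sum.inl x ∈ B) ∧ ∃ y, Sum.inr y ∈ B}.ncard

end PartitionMonoid

/-! The heart is that `π` is injective on the preimage of the `R`-class of every projection `q` of
rank `r ≤ n - 2`. Uniqueness of idempotent lifts and the structure of the maximal subgroups are then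
read off in the partition monoid.

All identities between partitions are checked on two-colourings: a partition is determined by its
compatible pairs (upper colouring, lower colouring), and the product becomes composition of
relations. `PG` is generated by the `x (merge m)`, which fuse points, and the `x (restrict Y)`,
which cut off the points outside `Y`. If `q` has kernel `m₀` and its transversals pass through the
points `c₀ i`, the elements of its `R`-class have the form `connect m₀ c₀ c m`, where `c` is a
configuration of `r` points separated by `m`.

It suffices to lift each `connect m₀ c₀ c ⊥` coherently to some `s c` in `PG`: every element over
the `R`-class is then an `s c * x (merge m)` (`IsTransport.rep_of_mul_eq`), and its image determines
it. Moving one point of `c` is right multiplication by a merge and a restriction. This transport has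
no monodromy around triangles and squares: a further merge that identifies the configurations
involved, but separates the points of each, makes all transports invisible (`mul_x_collapse`) and
can be cancelled (`eq_of_mul_x_merge_eq`). With `r + 2 ≤ n` the graph of configurations, with
triangles and squares filled in, is simply connected (`LocalSystem.exists_section`), so the
transport integrates to `s`. The induction there forgets one point: the fibres are complete graphs,
and edges of the base lift by parking the forgotten point at a free position. -/

/-! ### Local systems on configuration graphs -/

section LocalSystem

open Function

/-- Two configurations that differ at most in the `i`-th coordinate. -/
def AgreeOff {r : ℕ} {X : Type*} (i : Fin r) (c c' : Fin r → X) : Prop :=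
  ∀ j, j ≠ i → c j = c' j

theorem AgreeOff.symm {r : ℕ} {X : Type*} {i : Fin r} {c c' : Fin r → X} (h : AgreeOff i c c') :
    AgreeOff i c' c := fun j hj => (h j hj).symm

theorem AgreeOff.trans {r : ℕ} {X : Type*} {i : Fin r} {c c' c'' : Fin r → X}
    (h : AgreeOff i c c') (h' : AgreeOff i c' c'') : AgreeOff i c c'' :=
  fun j hj => (h j hj).trans (h' j hj)

theorem agreeOff_cons_zero {r : ℕ} {X : Type*} (c : Fin r → X) (z z' : X) :
    AgreeOff 0 (Fin.cons z c : Fin (r + 1) → X) (Fin.cons z' c) := by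
  intro j hj
  obtain ⟨k, rfl⟩ := Fin.exists_succ_eq.2 hj
  simp

theorem AgreeOff.cons {r : ℕ} {X : Type*} {i : Fin r} {c c' : Fin r → X} (h : AgreeOff i c c')
    (z : X) : AgreeOff i.succ (Fin.cons z c : Fin (r + 1) → X) (Fin.cons z c') := by
  intro j hj
  refine Fin.cases (fun _ => rfl) (fun k hk => ?_) j hj
  simpa using h k (fun e => hk (by rw [e]))

/-- A local system on the graph of injective configurations `Fin r → X`, whose edges change a
single coordinate: fibres in `F`, and transports along the edges that are compatible with the
triangles (one coordinate changes) and the squares (two coordinates change independently). -/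
structure LocalSystem (r : ℕ) (X F : Type*) where
  /-- the fibre over a configuration -/
  fib : (Fin r → X) → Set F
  /-- the transport between two adjacent configurations -/
  tr : (Fin r → X) → (Fin r → X) → F → F
  mem {i : Fin r} {c c' : Fin r → X} {w : F} : Injective c → Injective c' → AgreeOff i c c' →
    w ∈ fib c → tr c c' w ∈ fib c'
  refl {c : Fin r → X} {w : F} : Injective c → w ∈ fib c → tr c c w = w
  triangle {i : Fin r} {c c' c'' : Fin r → X} {w : F} : Injective c → Injective c' →
    Injective c'' → AgreeOff i c c' → AgreeOff i c' c'' → w ∈ fib c →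
    tr c' c'' (tr c c' w) = tr c c'' w
  square {i j : Fin r} {c₁ c₂ c₃ c₄ : Fin r → X} {w : F} : i ≠ j → Injective c₁ → Injective c₂ →
    Injective c₃ → Injective c₄ → AgreeOff i c₁ c₂ → AgreeOff j c₂ c₃ → AgreeOff j c₁ c₄ →
    AgreeOff i c₄ c₃ → w ∈ fib c₁ → tr c₂ c₃ (tr c₁ c₂ w) = tr c₄ c₃ (tr c₁ c₄ w)

namespace LocalSystem

variable {r : ℕ} {X F : Type*}

theorem exists_notMem_range [Fintype X] (c : Fin r → X) (s : Finset X)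
    (h : r + s.card < Fintype.card X) : ∃ z, z ∉ Set.range c ∧ z ∉ s := by
  classical
  have hc : (Finset.univ.image c ∪ s).card < (Finset.univ : Finset X).card := by
    refine lt_of_le_of_lt (Finset.card_union_le _ _) ?_
    have := Finset.card_image_le (s := (Finset.univ : Finset (Fin r))) (f := c)
    simp only [Finset.card_univ, Fintype.card_fin] at this ⊢
    omega
  obtain ⟨z, -, hz⟩ := Finset.exists_mem_notMem_of_card_lt_card hc
  exact ⟨z, by simpa using fun i hi => hz (by simp [← hi]), fun hs => hz (by simp [hs])⟩

theorem injective_cons {c : Fin r → X} {z : X} (hc : Injective c) (hz : z ∉ Set.range c) :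
    Injective (Fin.cons z c : Fin (r + 1) → X) :=
  Fin.cons_injective_iff.2 ⟨hz, hc⟩

theorem notMem_range_of_agreeOff {i : Fin r} {c c' : Fin r → X} {z : X} (h : AgreeOff i c c')
    (hz : z ∉ Set.range c) (hi : z ≠ c' i) : z ∉ Set.range c' := by
  rintro ⟨j, rfl⟩
  by_cases hj : j = i
  · exact hi (by rw [hj])
  · exact hz ⟨j, h j hj⟩

/-- The transport along the lift of an edge `c, c'` with the new coordinate at `z`, between the
base points `b c` and `b c'`. -/
def liftTr (L : LocalSystem (r + 1) X F) (b : (Fin r → X) → X) (z : X) (c c' : Fin r → X)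
    (w : F) : F :=
  L.tr (Fin.cons z c') (Fin.cons (b c') c')
    (L.tr (Fin.cons z c) (Fin.cons z c') (L.tr (Fin.cons (b c) c) (Fin.cons z c) w))

/-! ### Forgetting one point of a configuration -/

section lift

variable (L : LocalSystem (r + 1) X F) {b : (Fin r → X) → X}

theorem liftTr_mem (hb : ∀ c, b c ∉ Set.range c)
    {i : Fin r} {c c' : Fin r → X} {z : X} {w : F} (hc : Injective c)
    (hc' : Injective c') (hz : z ∉ Set.range c) (hz' : z ∉ Set.range c') (h : AgreeOff i c c')
    (hw : w ∈ L.fib (Fin.cons (b c) c)) : L.liftTr b z c c' w ∈ L.fib (Fin.cons (b c') c') :=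
  L.mem (injective_cons hc' hz') (injective_cons hc' (hb _)) (agreeOff_cons_zero _ _ _)
    (L.mem (injective_cons hc hz) (injective_cons hc' hz') (h.cons z)
      (L.mem (injective_cons hc (hb _)) (injective_cons hc hz) (agreeOff_cons_zero _ _ _) hw))

/-- The two parking positions `z` and `z₁` are compared by a triangle over `c`, a square along the
edge, and a triangle over `c'`. -/
theorem liftTr_eq (hb : ∀ c, b c ∉ Set.range c)
    {i : Fin r} {c c' : Fin r → X} {z z₁ : X} {w : F} (hc : Injective c)
    (hc' : Injective c') (hz : z ∉ Set.range c) (hz' : z ∉ Set.range c') (hz₁ : z₁ ∉ Set.range c)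
    (hz₁' : z₁ ∉ Set.range c') (h : AgreeOff i c c') (hw : w ∈ L.fib (Fin.cons (b c) c)) :
    L.liftTr b z c c' w = L.liftTr b z₁ c c' w := by
  have hw1 := L.mem (injective_cons hc (hb _)) (injective_cons hc hz)
    (agreeOff_cons_zero c (b c) z) hw
  have hw2 := L.mem (injective_cons hc hz) (injective_cons hc' hz') (h.cons z) hw1
  have e1 := L.triangle (injective_cons hc (hb c)) (injective_cons hc hz) (injective_cons hc hz₁)
    (agreeOff_cons_zero c (b c) z) (agreeOff_cons_zero c z z₁) hw
  have e2 := L.square (i := 0) (j := i.succ) (Fin.succ_ne_zero i).symm (injective_cons hc hz)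
    (injective_cons hc hz₁) (injective_cons hc' hz₁') (injective_cons hc' hz')
    (agreeOff_cons_zero c z z₁) (h.cons z₁) (h.cons z) (agreeOff_cons_zero c' z z₁) hw1
  have e3 := L.triangle (injective_cons hc' hz') (injective_cons hc' hz₁')
    (injective_cons hc' (hb c')) (agreeOff_cons_zero c' z z₁) (agreeOff_cons_zero c' z₁ (b c')) hw2
  rw [liftTr, liftTr, ← e1, e2, e3]

/-- Going back to the coordinate `z` after a lifted transport. -/
theorem tr_liftTr (hb : ∀ c, b c ∉ Set.range c)
    {i : Fin r} {c c' : Fin r → X} {z : X} {w : F} (hc : Injective c)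
    (hc' : Injective c') (hz : z ∉ Set.range c) (hz' : z ∉ Set.range c')
    (h : AgreeOff i c c') (hw : w ∈ L.fib (Fin.cons (b c) c)) :
    L.tr (Fin.cons (b c') c') (Fin.cons z c') (L.liftTr b z c c' w) =
      L.tr (Fin.cons z c) (Fin.cons z c') (L.tr (Fin.cons (b c) c) (Fin.cons z c) w) := by
  have hw1 := L.mem (injective_cons hc (hb _)) (injective_cons hc hz)
    (agreeOff_cons_zero c (b c) z) hw
  have hw2 := L.mem (injective_cons hc hz) (injective_cons hc' hz') (h.cons z) hw1
  rw [liftTr, L.triangle (injective_cons hc' hz') (injective_cons hc' (hb c'))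
    (injective_cons hc' hz') (agreeOff_cons_zero c' z _) (agreeOff_cons_zero c' _ z) hw2,
    L.refl (injective_cons hc' hz') hw2]

theorem liftTr_self (hb : ∀ c, b c ∉ Set.range c)
    {c : Fin r → X} {z : X} {w : F} (hc : Injective c)
    (hz : z ∉ Set.range c) (hw : w ∈ L.fib (Fin.cons (b c) c)) : L.liftTr b z c c w = w := by
  have hw1 := L.mem (injective_cons hc (hb _)) (injective_cons hc hz)
    (agreeOff_cons_zero c (b c) z) hw
  rw [liftTr, L.refl (injective_cons hc hz) hw1, L.triangle (injective_cons hc (hb c))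
    (injective_cons hc hz) (injective_cons hc (hb c)) (agreeOff_cons_zero c _ z)
    (agreeOff_cons_zero c z _) hw, L.refl (injective_cons hc (hb c)) hw]

theorem liftTr_triangle (hb : ∀ c, b c ∉ Set.range c)
    {i : Fin r} {c c' c'' : Fin r → X} {z : X} {w : F} (hc : Injective c)
    (hc' : Injective c') (hc'' : Injective c'') (hz : z ∉ Set.range c) (hz' : z ∉ Set.range c')
    (hz'' : z ∉ Set.range c'') (h : AgreeOff i c c') (h' : AgreeOff i c' c'')
    (hw : w ∈ L.fib (Fin.cons (b c) c)) :
    L.liftTr b z c' c'' (L.liftTr b z c c' w) = L.liftTr b z c c'' w := by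
  have hw1 := L.mem (injective_cons hc (hb _)) (injective_cons hc hz)
    (agreeOff_cons_zero c (b c) z) hw
  conv_lhs => rw [liftTr]
  rw [L.tr_liftTr hb hc hc' hz hz' h hw, L.triangle (injective_cons hc hz) (injective_cons hc' hz')
    (injective_cons hc'' hz'') (h.cons z) (h'.cons z) hw1, ← liftTr]

theorem liftTr_square (hb : ∀ c, b c ∉ Set.range c)
    {i j : Fin r} {c₁ c₂ c₃ c₄ : Fin r → X} {z : X} {w : F} (hij : i ≠ j)
    (hc₁ : Injective c₁) (hc₂ : Injective c₂) (hc₃ : Injective c₃) (hc₄ : Injective c₄)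
    (hz₁ : z ∉ Set.range c₁) (hz₂ : z ∉ Set.range c₂) (hz₃ : z ∉ Set.range c₃)
    (hz₄ : z ∉ Set.range c₄) (h₁₂ : AgreeOff i c₁ c₂) (h₂₃ : AgreeOff j c₂ c₃)
    (h₁₄ : AgreeOff j c₁ c₄) (h₄₃ : AgreeOff i c₄ c₃) (hw : w ∈ L.fib (Fin.cons (b c₁) c₁)) :
    L.liftTr b z c₂ c₃ (L.liftTr b z c₁ c₂ w) = L.liftTr b z c₄ c₃ (L.liftTr b z c₁ c₄ w) := by
  have hw1 := L.mem (injective_cons hc₁ (hb _)) (injective_cons hc₁ hz₁)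
    (agreeOff_cons_zero c₁ (b c₁) z) hw
  rw [liftTr, L.tr_liftTr hb hc₁ hc₂ hz₁ hz₂ h₁₂ hw, liftTr, L.tr_liftTr hb hc₁ hc₄ hz₁ hz₄ h₁₄ hw,
    L.square (i := i.succ) (j := j.succ) (by simpa using hij) (injective_cons hc₁ hz₁)
      (injective_cons hc₂ hz₂) (injective_cons hc₃ hz₃) (injective_cons hc₄ hz₄) (h₁₂.cons z)
      (h₂₃.cons z) (h₁₄.cons z) (h₄₃.cons z) hw1]

/-- The local system on `Fin r → X` obtained by restricting to base points of the fibres of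
`Fin (r + 1) → X` over `Fin r → X`. -/
theorem exists_lift (hb : ∀ c, b c ∉ Set.range c)
    [Fintype X] (hX : r + 3 ≤ Fintype.card X) :
    ∃ L' : LocalSystem r X F, (∀ c, L'.fib c = L.fib (Fin.cons (b c) c)) ∧
      ∀ {i : Fin r} {c c' : Fin r → X} {z : X} {w : F}, Injective c → Injective c' →
        z ∉ Set.range c → z ∉ Set.range c' → AgreeOff i c c' → w ∈ L'.fib c →
        L'.tr c c' w = L.liftTr b z c c' w := by
  classical
  have hne : Nonempty X := Fintype.card_pos_iff.1 (by omega)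
  -- A parking position free for both ends, if there is one; otherwise a junk value, harmless
  -- because the laws concern edges only.
  let ζ : (Fin r → X) → (Fin r → X) → X := fun c c' =>
    Classical.epsilon fun z => z ∉ Set.range c ∧ z ∉ Set.range c'
  have hζ : ∀ {c c' : Fin r → X} {z : X}, z ∉ Set.range c → z ∉ Set.range c' →
      ζ c c' ∉ Set.range c ∧ ζ c c' ∉ Set.range c' := fun {c c' z} hz hz' =>
    Classical.epsilon_spec (p := fun z => z ∉ Set.range c ∧ z ∉ Set.range c') ⟨z, hz, hz'⟩
  have key : ∀ {i : Fin r} {c c' : Fin r → X} {z : X} {w : F}, Injective c → Injective c' →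
      z ∉ Set.range c → z ∉ Set.range c' → AgreeOff i c c' → w ∈ L.fib (Fin.cons (b c) c) →
      L.liftTr b (ζ c c') c c' w = L.liftTr b z c c' w := fun hc hc' hz hz' h hw =>
    L.liftTr_eq hb hc hc' (hζ hz hz').1 (hζ hz hz').2 hz hz' h hw
  -- A triangle or a square occupies at most `r + 2` positions: those of one corner and two more.
  -- This is where `r + 3 ≤ card X` is needed.
  have avoid : ∀ (c : Fin r → X) (x y : X), ∃ z, z ∉ Set.range c ∧ z ≠ x ∧ z ≠ y := by
    intro c x y
    obtain ⟨z, hz, hz'⟩ := exists_notMem_range c {x, y}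
      (lt_of_le_of_lt (Nat.add_le_add_left Finset.card_le_two r) (by omega))
    exact ⟨z, hz, by simpa using hz'⟩
  refine ⟨{ fib := fun c => L.fib (Fin.cons (b c) c)
            tr := fun c c' => L.liftTr b (ζ c c') c c'
            mem := ?_, refl := ?_, triangle := ?_, square := ?_ }, fun _ => rfl, key⟩
  · intro i c c' w hc hc' h hw
    obtain ⟨z, hz, hz1, -⟩ := avoid c (c' i) (c' i)
    have hz' := notMem_range_of_agreeOff h hz hz1
    exact L.liftTr_mem hb hc hc' (hζ hz hz').1 (hζ hz hz').2 h hw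
  · intro c w hc hw
    exact L.liftTr_self hb hc (hζ (hb c) (hb c)).1 hw
  · intro i c c' c'' w hc hc' hc'' h h' hw
    obtain ⟨z, hz, hz1, hz2⟩ := avoid c (c' i) (c'' i)
    have hz' := notMem_range_of_agreeOff h hz hz1
    have hz'' := notMem_range_of_agreeOff h' hz' hz2
    rw [key hc hc' hz hz' h hw, key hc hc'' hz hz'' (h.trans h') hw,
      key hc' hc'' hz' hz'' h' (L.liftTr_mem hb hc hc' hz hz' h hw),
      L.liftTr_triangle hb hc hc' hc'' hz hz' hz'' h h' hw]
  · intro i j c₁ c₂ c₃ c₄ w hij hc₁ hc₂ hc₃ hc₄ h₁₂ h₂₃ h₁₄ h₄₃ hw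
    obtain ⟨z, hz₁, hz, hz'⟩ := avoid c₁ (c₂ i) (c₄ j)
    have hz₂ := notMem_range_of_agreeOff h₁₂ hz₁ hz
    have hz₄ := notMem_range_of_agreeOff h₁₄ hz₁ hz'
    -- The `j`-th point of the opposite corner `c₃` is already that of `c₄`, so no third position
    -- has to be avoided.
    have hz₃ := notMem_range_of_agreeOff h₂₃ hz₂ (by rwa [← h₄₃ j hij.symm])
    rw [key hc₁ hc₂ hz₁ hz₂ h₁₂ hw, key hc₁ hc₄ hz₁ hz₄ h₁₄ hw,
      key hc₂ hc₃ hz₂ hz₃ h₂₃ (L.liftTr_mem hb hc₁ hc₂ hz₁ hz₂ h₁₂ hw),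
      key hc₄ hc₃ hz₄ hz₃ h₄₃ (L.liftTr_mem hb hc₁ hc₄ hz₁ hz₄ h₁₄ hw),
      L.liftTr_square hb hij hc₁ hc₂ hc₃ hc₄ hz₁ hz₂ hz₃ hz₄ h₁₂ h₂₃ h₁₄ h₄₃ hw]

end lift

/-- If there are at least two free positions, then every point of a fibre of a local system extends
to a global section: the configuration graph, with the triangles and squares filled in, is simply
connected. -/
theorem exists_section [Fintype X] (L : LocalSystem r X F) (hX : r + 2 ≤ Fintype.card X)
    {c₀ : Fin r → X} (hc₀ : Injective c₀) {w₀ : F} (hw₀ : w₀ ∈ L.fib c₀) :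
    ∃ s : (Fin r → X) → F, s c₀ = w₀ ∧ (∀ c, Injective c → s c ∈ L.fib c) ∧
      ∀ (i : Fin r) (c c' : Fin r → X), Injective c → Injective c' → AgreeOff i c c' →
        L.tr c c' (s c) = s c' := by
  induction r generalizing w₀ with
  | zero =>
    exact ⟨fun _ => w₀, rfl, fun c _ => by rwa [Subsingleton.elim c c₀], fun i => i.elim0⟩
  | succ r ih =>
    have hb : ∀ c : Fin r → X, ∃ z, z ∉ Set.range c := fun c =>
      (exists_notMem_range c ∅ (by simp; omega)).imp fun _ h => h.1
    choose b hb using hb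
    obtain ⟨L', hfib, htr⟩ := L.exists_lift hb (by omega)
    have split : ∀ c : Fin (r + 1) → X, Injective c →
        Injective (Fin.tail c) ∧ c 0 ∉ Set.range (Fin.tail c) := by
      intro c hc
      rw [← Fin.cons_self_tail c, Fin.cons_injective_iff] at hc
      exact ⟨by simpa using hc.2, by simpa using hc.1⟩
    have ag : ∀ c : Fin (r + 1) → X, AgreeOff 0 (Fin.cons (b (Fin.tail c)) (Fin.tail c)) c := by
      intro c
      conv => rw [← Fin.cons_self_tail c]
      simpa using agreeOff_cons_zero (Fin.tail c) (b (Fin.tail c)) (c 0)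
    have inj : ∀ c : Fin (r + 1) → X, Injective c →
        Injective (Fin.cons (b (Fin.tail c)) (Fin.tail c) : Fin (r + 1) → X) := fun c hc =>
      injective_cons (split c hc).1 (hb _)
    obtain ⟨s, hs₀, hs, hstep⟩ := ih L' (by omega) (split c₀ hc₀).1
      (w₀ := L.tr c₀ (Fin.cons (b (Fin.tail c₀)) (Fin.tail c₀)) w₀)
      (by rw [hfib]; exact L.mem hc₀ (inj c₀ hc₀) (ag c₀).symm hw₀)
    have hs1 : ∀ c : Fin (r + 1) → X, Injective c →
        s (Fin.tail c) ∈ L.fib (Fin.cons (b (Fin.tail c)) (Fin.tail c)) := fun c hc => by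
      rw [← hfib]; exact hs _ (split c hc).1
    -- The section downstairs lives at the base points `b`; moving the first point from there to `c
    -- 0` extends it over each fibre.
    refine ⟨fun c => L.tr (Fin.cons (b (Fin.tail c)) (Fin.tail c)) c (s (Fin.tail c)), ?_, ?_, ?_⟩
    · change L.tr _ c₀ (s (Fin.tail c₀)) = w₀
      rw [hs₀, L.triangle hc₀ (inj c₀ hc₀) hc₀ (ag c₀).symm (ag c₀) hw₀, L.refl hc₀ hw₀]
    · intro c hc
      exact L.mem (inj c hc) hc (ag c) (hs1 c hc)
    · intro i c c' hc hc' h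
      dsimp only
      rcases Fin.eq_zero_or_eq_succ i with rfl | ⟨j, rfl⟩
      · have e : Fin.tail c = Fin.tail c' := funext fun k => h k.succ (Fin.succ_ne_zero k)
        rw [L.triangle (inj c hc) hc hc' (ag c) h (hs1 c hc), e]
      · have h0 : c 0 = c' 0 := h 0 (Fin.succ_ne_zero j).symm
        have ht : AgreeOff j (Fin.tail c) (Fin.tail c') := fun k hk =>
          h k.succ (by simpa using hk)
        have hz' : c 0 ∉ Set.range (Fin.tail c') := h0 ▸ (split c' hc').2
        have e1 : (Fin.cons (c 0) (Fin.tail c) : Fin (r + 1) → X) = c := Fin.cons_self_tail c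
        have e2 : (Fin.cons (c 0) (Fin.tail c') : Fin (r + 1) → X) = c' := by
          rw [h0]; exact Fin.cons_self_tail c'
        -- The first point stays put, so its own position `c 0` can serve as the parking position.
        have := L.tr_liftTr hb (split c hc).1 (split c' hc').1 (split c hc).2 hz' ht (hs1 c hc)
        rw [← hstep j _ _ (split c hc).1 (split c' hc').1 ht,
          htr (split c hc).1 (split c' hc').1 (split c hc).2 hz' ht (hs _ (split c hc).1)]
        rw [e1, e2] at this
        exact this.symm

end LocalSystem

end LocalSystem

/-! ### The free projection-generated semigroup: consequences of the relations -/

namespace PG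

variable {S : Type*} [Semigroup S] [RegularStarSemigroup S]

theorem x_mul_self (p : Projections S) : x p * x p = x p := isIdempotentElem_x p

theorem x_mul_x_mul_x {p q t : Projections S} (h : (p * q * p : S) = t) :
    x p * x q * x p = x t := by
  have e : p.theta q = t := Subtype.ext h
  rw [← e]
  exact (Con.eq _).2 (ConGen.Rel.of _ _ (PGRel.theta p q))

theorem isIdempotentElem_x_mul_x (p q : Projections S) : IsIdempotentElem (x p * x q) :=
  (Con.eq _).2 (ConGen.Rel.of _ _ (PGRel.mul_idem p q))

/-- If the product of two projections is a projection, then the product of the corresponding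
generators is the corresponding generator. -/
theorem x_mul_x {p q t : Projections S} (h : (p * q : S) = t) : x p * x q = x t := by
  have hs : (q * p : S) = t := by
    rw [← t.2.isSelfAdjoint.star_eq, ← h, star_mul, p.2.isSelfAdjoint.star_eq,
      q.2.isSelfAdjoint.star_eq]
  have hp : (p * t : S) = t := by rw [← h, ← mul_assoc, p.2.isIdempotentElem.eq]
  have hq : (q * t : S) = t := by rw [← hs, ← mul_assoc, q.2.isIdempotentElem.eq]
  have htq : (t * q : S) = t := by rw [← h, mul_assoc, q.2.isIdempotentElem.eq]
  have e1 : x p * x q * x p = x t := x_mul_x_mul_x (by rw [mul_assoc, hs, hp])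
  have e2 : x q * x t * x q = x t := x_mul_x_mul_x (by rw [hq, htq])
  calc x p * x q = x p * x q * x p * x q := by
        rw [mul_assoc (x p * x q), (isIdempotentElem_x_mul_x p q).eq]
    _ = x q * x t * (x q * x q) := by rw [e1, ← mul_assoc, e2]
    _ = x t := by rw [x_mul_self, e2]

theorem induction_on {C : PG S → Prop} (w : PG S) (hx : ∀ p, C (x p))
    (hmul : ∀ u v, C u → C v → C (u * v)) : C w := by
  induction w using Con.induction_on with
  | H w =>
    induction w using FreeSemigroup.recOnMul with
    | ih1 p => exact hx p
    | ih2 p w hp hw => exact hmul _ _ (hx p) hw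

theorem isStarProjection_mul_star (a : S) : IsStarProjection (a * star a) := by
  constructor
  · change a * star a * (a * star a) = a * star a
    rw [← mul_assoc, RegularStarSemigroup.mul_star_mul_self]
  · change star (a * star a) = a * star a
    rw [star_mul, star_star]

/-- The projection `a a*`. -/
def leftProj (a : S) : Projections S := ⟨a * star a, isStarProjection_mul_star a⟩

theorem leftProj_mul (a : S) : (leftProj a : S) * a = a :=
  RegularStarSemigroup.mul_star_mul_self a

/-- Induction on the word: if `f` is the left projection of the tail `v`, that of `p v` is `p f p`,
whose generator is `x p * x f * x p`; the idempotency of `x p * x f` then absorbs the prefix. -/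
theorem x_leftProj_mul (w : PG S) : x (leftProj (toSemigroup S w)) * w = w := by
  induction w using Con.induction_on with
  | H w =>
    induction w using FreeSemigroup.recOnMul with
    | ih1 p =>
      change x (leftProj (p : S)) * x p = x p
      exact x_mul_x (leftProj_mul _)
    | ih2 p w hp hw =>
      set v : PG S := (w : PG S) with hv
      change x (leftProj (toSemigroup S (x p * v))) * (x p * v) = x p * v
      set f := leftProj (toSemigroup S v)
      have e : x p * x f * x p = x (leftProj (toSemigroup S (x p * v))) := by
        refine x_mul_x_mul_x ?_
        simp only [f, leftProj, map_mul, toSemigroup_x, star_mul, p.2.isSelfAdjoint.star_eq,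
          mul_assoc]
      rw [← e]
      calc x p * x f * x p * (x p * v) = x p * x f * (x p * x p) * v := by simp only [mul_assoc]
        _ = x p * x f * x p * (x f * v) := by rw [x_mul_self, hw]
        _ = (x p * x f * (x p * x f)) * v := by simp only [mul_assoc]
        _ = x p * v := by rw [(isIdempotentElem_x_mul_x p f).eq, mul_assoc, hw]

theorem x_mul_of_mul_eq {q : Projections S} {w : PG S}
    (h : (q : S) * toSemigroup S w = toSemigroup S w) : x q * w = w := by
  have e : x q * x (leftProj (toSemigroup S w)) = x (leftProj (toSemigroup S w)) :=
    x_mul_x (by simp only [leftProj]; rw [← mul_assoc, h])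
  rw [← x_leftProj_mul w, ← mul_assoc, e]

end PG

/-! ### Maximal subgroups of `R`-related idempotents -/

section Green

variable {S : Type*} [Semigroup S]

theorem mem_maximalSubgroup_iff {e : S} {he : IsIdempotentElem e} {a : S} :
    a ∈ maximalSubgroup e he ↔ e * a = a ∧ a * e = a ∧ (∃ s, a * s = e) ∧ ∃ s, s * a = e := by
  constructor
  · rintro ⟨⟨h1, h2⟩, h3, h4⟩
    refine ⟨h3.mul_eq he, h1.mul_eq he, ?_, ?_⟩
    · rcases h4 with rfl | ⟨s, hs⟩
      exacts [⟨_, he⟩, ⟨s, hs.symm⟩]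
    · rcases h2 with rfl | ⟨s, hs⟩
      exacts [⟨_, he⟩, ⟨s, hs.symm⟩]
  · rintro ⟨h1, h2, ⟨s, hs⟩, t, ht⟩
    exact ⟨⟨.inr ⟨a, h2.symm⟩, .inr ⟨t, ht.symm⟩⟩, .inr ⟨a, h1.symm⟩, .inr ⟨s, hs.symm⟩⟩

theorem mul_mem_maximalSubgroup {e f a : S} {he : IsIdempotentElem e} (hf : IsIdempotentElem f)
    (hef : e * f = f) (hfe : f * e = e) (ha : a ∈ maximalSubgroup e he) :
    a * f ∈ maximalSubgroup f hf := by
  obtain ⟨h1, h2, ⟨s, hs⟩, t, ht⟩ := mem_maximalSubgroup_iff.1 ha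
  refine mem_maximalSubgroup_iff.2 ⟨?_, by rw [mul_assoc, hf.eq], ⟨e * s * f, ?_⟩, t, ?_⟩
  · rw [← h1, ← mul_assoc, ← mul_assoc, hfe]
  · calc a * f * (e * s * f) = a * (f * e) * s * f := by simp only [mul_assoc]
      _ = f := by rw [hfe, h2, hs, hef]
  · rw [← mul_assoc, ht, hef]

/-- `R`-related idempotents have isomorphic maximal subgroups. -/
def maximalSubgroupEquiv {e f : S} (he : IsIdempotentElem e) (hf : IsIdempotentElem f)
    (hef : e * f = f) (hfe : f * e = e) : maximalSubgroup e he ≃* maximalSubgroup f hf where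
  toFun a := ⟨a * f, mul_mem_maximalSubgroup hf hef hfe a.2⟩
  invFun a := ⟨a * e, mul_mem_maximalSubgroup he hfe hef a.2⟩
  left_inv a := Subtype.ext (by
    simp only; rw [mul_assoc, hfe, (mem_maximalSubgroup_iff.1 a.2).2.1])
  right_inv a := Subtype.ext (by
    simp only; rw [mul_assoc, hef, (mem_maximalSubgroup_iff.1 a.2).2.1])
  map_mul' a b := Subtype.ext (by
    change (a : S) * b * f = a * f * (b * f)
    have h1 := (mem_maximalSubgroup_iff.1 b.2).1
    have h2 : f * (b : S) = b := by rw [← h1, ← mul_assoc, hfe]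
    rw [mul_assoc (a : S) f, ← mul_assoc f, h2, mul_assoc])

end Green

/-! ### Some elements of the partition monoid -/

namespace PartitionMonoid

variable {X ι : Type*}

/-- The partition generated by a relation. -/
def ofRel (R : X ⊕ X → X ⊕ X → Prop) : PartitionMonoid X := ⟨Relation.EqvGen.setoid R⟩

theorem compat_ofRel {R : X ⊕ X → X ⊕ X → Prop} {f g : X → Prop} :
    Compat (ofRel R) f g ↔ ∀ u v, R u v → Sum.elim f g u = Sum.elim f g v := by
  refine ⟨fun h u v huv => h u v (.rel _ _ huv), fun h u v huv => ?_⟩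
  induction huv with
  | rel _ _ h' => exact h _ _ h'
  | refl => rfl
  | symm _ _ _ ih => exact ih.symm
  | trans _ _ _ _ _ ih1 ih2 => exact ih1.trans ih2

/-- On colourings, a symmetric transitive relation that is reflexive on its domain equals its
converse and its own square. -/
theorem isStarProjection_of_compat {a : PartitionMonoid X}
    (hs : ∀ f g, Compat a f g → Compat a g f)
    (ht : ∀ f g k, Compat a f g → Compat a g k → Compat a f k)
    (hr : ∀ f g, Compat a f g → Compat a f f) : IsStarProjection a := by
  constructor
  · refine ext_compat fun f g => ?_
    rw [compat_mul]
    exact ⟨fun ⟨k, h1, h2⟩ => ht _ _ _ h1 h2, fun h => ⟨f, hr _ _ h, h⟩⟩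
  · refine ext_compat fun f g => ?_
    rw [compat_star]
    exact ⟨hs _ _, hs _ _⟩

/-- The partition with blocks `A ∪ A'`, where `A` is a class of `m`. -/
def mergeRel (m : Setoid X) : PartitionMonoid X := ⟨Setoid.comap (Sum.elim id id) m⟩

theorem compat_mergeRel {m : Setoid X} {f g : X → Prop} :
    Compat (mergeRel m) f g ↔ f = g ∧ m ≤ Setoid.ker f := by
  constructor
  · intro h
    exact ⟨funext fun x => h (.inl x) (.inr x) (m.refl' x), fun x y hxy => h (.inl x) (.inl y) hxy⟩
  · rintro ⟨rfl, h⟩ u v huv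
    have e : ∀ u, Sum.elim f f u = f (Sum.elim id id u) := by rintro (u | u) <;> rfl
    rw [e, e]
    exact h huv

/-- The projection with blocks `A ∪ A'`, where `A` is a class of `m`. -/
def merge (m : Setoid X) : Projections (PartitionMonoid X) :=
  ⟨mergeRel m, isStarProjection_of_compat
    (by simp only [compat_mergeRel]; rintro f g ⟨rfl, h⟩; exact ⟨rfl, h⟩)
    (by simp only [compat_mergeRel]; rintro f g k ⟨rfl, h⟩ h'; exact h')
    (fun f g h => compat_mergeRel.2 ⟨rfl, (compat_mergeRel.1 h).2⟩)⟩

theorem compat_merge {m : Setoid X} {f g : X → Prop} :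
    Compat (merge m).1 f g ↔ f = g ∧ m ≤ Setoid.ker f := compat_mergeRel

/-- The partition with blocks `{x, x'}` for `x ∈ Y`, and singletons. -/
def restrictRel (Y : Set X) : PartitionMonoid X :=
  ofRel fun u v => ∃ x ∈ Y, u = .inl x ∧ v = .inr x

theorem compat_restrictRel {Y : Set X} {f g : X → Prop} :
    Compat (restrictRel Y) f g ↔ ∀ x ∈ Y, f x = g x := by
  rw [restrictRel, compat_ofRel]
  refine ⟨fun h x hx => h _ _ ⟨x, hx, rfl, rfl⟩, ?_⟩
  rintro h _ _ ⟨x, hx, rfl, rfl⟩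
  exact h x hx

/-- The projection with blocks `{x, x'}` for `x ∈ Y`, and singletons. -/
def restrict (Y : Set X) : Projections (PartitionMonoid X) :=
  ⟨restrictRel Y, isStarProjection_of_compat
    (by simp only [compat_restrictRel]; exact fun f g h x hx => (h x hx).symm)
    (by simp only [compat_restrictRel]; exact fun f g k h h' x hx => (h x hx).trans (h' x hx))
    (fun f g h => compat_restrictRel.2 fun x hx => rfl)⟩

theorem compat_restrict {Y : Set X} {f g : X → Prop} :
    Compat (restrict Y).1 f g ↔ ∀ x ∈ Y, f x = g x := compat_restrictRel

/-- The partition with upper kernel generated by `m₀`, lower kernel generated by `m`, and the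
upper points `c₀ i` connected to the lower points `c i`. -/
def connect (m₀ : Setoid X) (c₀ c : ι → X) (m : Setoid X) : PartitionMonoid X :=
  ofRel fun u v => (∃ x y, m₀ x y ∧ u = .inl x ∧ v = .inl y) ∨
    (∃ x y, m x y ∧ u = .inr x ∧ v = .inr y) ∨ ∃ i, u = .inl (c₀ i) ∧ v = .inr (c i)

theorem compat_connect {m₀ m : Setoid X} {c₀ c : ι → X} {f g : X → Prop} :
    Compat (connect m₀ c₀ c m) f g ↔
      m₀ ≤ Setoid.ker f ∧ m ≤ Setoid.ker g ∧ ∀ i, f (c₀ i) = g (c i) := by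
  rw [connect, compat_ofRel]
  constructor
  · exact fun h => ⟨fun x y hxy => h _ _ (.inl ⟨x, y, hxy, rfl, rfl⟩),
      fun x y hxy => h _ _ (.inr (.inl ⟨x, y, hxy, rfl, rfl⟩)),
      fun i => h _ _ (.inr (.inr ⟨i, rfl, rfl⟩))⟩
  · rintro ⟨h1, h2, h3⟩ _ _ (⟨x, y, h, rfl, rfl⟩ | ⟨x, y, h, rfl, rfl⟩ | ⟨i, rfl, rfl⟩)
    exacts [h1 h, h2 h, h3 i]

/-! ### Separated points, equivalences and two-colourings -/

/-- The points `c i` are in different classes of `m`. -/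
def Separates (m : Setoid X) (c : ι → X) : Prop := ∀ i j, m (c i) (c j) → i = j

theorem Separates.injective {m : Setoid X} {c : ι → X} (h : Separates m c) :
    Function.Injective c := fun i j hij => h i j (hij ▸ m.refl' _)

theorem Separates.congr {m : Setoid X} {c c' : ι → X} (h : Separates m c)
    (hc : ∀ i, m (c i) (c' i)) : Separates m c' := fun i j hij =>
  h i j (m.trans' (hc i) (m.trans' hij (m.symm' (hc j))))

/-- A colouring that is constant on the classes of `m` and has prescribed values at the `c i`. -/
theorem Separates.exists_extension {m : Setoid X} {c : ι → X} (h : Separates m c) (φ : ι → Prop) :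
    ∃ f : X → Prop, m ≤ Setoid.ker f ∧ ∀ i, f (c i) = φ i := by
  refine ⟨fun x => ∃ i, m (c i) x ∧ φ i, fun x y hxy => propext ?_, fun i => propext ?_⟩
  · exact ⟨fun ⟨i, h1, h2⟩ => ⟨i, m.trans' h1 hxy, h2⟩,
      fun ⟨i, h1, h2⟩ => ⟨i, m.trans' h1 (m.symm' hxy), h2⟩⟩
  · exact ⟨fun ⟨j, h1, h2⟩ => h _ _ h1 ▸ h2, fun hi => ⟨i, m.refl' _, hi⟩⟩

theorem le_ker_class (m : Setoid X) (x : X) : m ≤ Setoid.ker (fun y => m x y) := fun _ _ h =>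
  propext ⟨fun k => m.trans' k h, fun k => m.trans' k (m.symm' h)⟩

/-- The indicator of a single class is enough to detect an equivalence. -/
theorem setoid_le_of_ker {m m' : Setoid X}
    (h : ∀ f : X → Prop, m' ≤ Setoid.ker f → m ≤ Setoid.ker f) : m ≤ m' := fun x y hxy => by
  have := h _ (le_ker_class m' x) hxy
  change (m' x x) = (m' x y) at this
  exact this ▸ m'.refl' x

/-- The smallest equivalence that relates `c i` and `c' i` for all `i`. -/
def link (c c' : ι → X) : Setoid X :=
  Relation.EqvGen.setoid fun x y => ∃ i, x = c i ∧ y = c' i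

theorem link_le {c c' : ι → X} {m : Setoid X} : link c c' ≤ m ↔ ∀ i, m (c i) (c' i) := by
  refine ⟨fun h i => h (.rel _ _ ⟨i, rfl, rfl⟩), fun h x y hxy => ?_⟩
  induction hxy with
  | rel _ _ h' => obtain ⟨i, rfl, rfl⟩ := h'; exact h i
  | refl => exact m.refl' _
  | symm _ _ _ ih => exact m.symm' ih
  | trans _ _ _ _ _ ih1 ih2 => exact m.trans' ih1 ih2

/-- The equivalence `m` on `Y`, with the points outside `Y` isolated. -/
def isolate (m : Setoid X) (Y : Set X) : Setoid X where
  r x y := x = y ∨ (x ∈ Y ∧ y ∈ Y ∧ m x y)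
  iseqv := by
    refine ⟨fun x => .inl rfl, ?_, ?_⟩
    · rintro x y (rfl | ⟨h1, h2, h3⟩)
      exacts [.inl rfl, .inr ⟨h2, h1, m.symm' h3⟩]
    · rintro x y z (rfl | ⟨h1, h2, h3⟩) (rfl | ⟨h4, h5, h6⟩)
      exacts [.inl rfl, .inr ⟨h4, h5, h6⟩, .inr ⟨h1, h2, h3⟩, .inr ⟨h1, h5, m.trans' h3 h6⟩]

theorem isolate_le (m : Setoid X) (Y : Set X) : isolate m Y ≤ m := by
  rintro x y (rfl | ⟨-, -, h⟩)
  exacts [m.refl' x, h]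

/-! ### Relations between the generators for `merge` and `restrict` -/

open PG

theorem x_merge_mul_x_merge (m m' : Setoid X) :
    x (merge m) * x (merge m') = x (merge (m ⊔ m')) := by
  refine x_mul_x (ext_compat fun f g => ?_)
  simp only [compat_mul, compat_merge, sup_le_iff]
  constructor
  · rintro ⟨k, ⟨rfl, h1⟩, rfl, h2⟩
    exact ⟨rfl, h1, h2⟩
  · rintro ⟨rfl, h1, h2⟩
    exact ⟨f, ⟨rfl, h1⟩, rfl, h2⟩

theorem x_merge_mul_x_merge_of_le {m m' : Setoid X} (h : m ≤ m') :
    x (merge m) * x (merge m') = x (merge m') := by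
  rw [x_merge_mul_x_merge, sup_eq_right.2 h]

theorem x_restrict_mul_x_restrict {Y Y' : Set X} (h : Y ⊆ Y') :
    x (restrict Y) * x (restrict Y') = x (restrict Y) := by
  refine x_mul_x (ext_compat fun f g => ?_)
  simp only [compat_mul, compat_restrict]
  constructor
  · rintro ⟨k, h1, h2⟩ y hy
    rw [h1 y hy, h2 y (h hy)]
  · intro h1
    exact ⟨g, h1, fun _ _ => rfl⟩

/-- Colours at points in different classes can be prescribed independently, so the merge imposes
nothing on the points that survive the restriction. -/
theorem x_restrict_merge_restrict {m : Setoid X} {c : ι → X} (h : Separates m c) :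
    x (restrict (Set.range c)) * x (merge m) * x (restrict (Set.range c)) =
      x (restrict (Set.range c)) := by
  refine x_mul_x_mul_x (ext_compat fun f g => ?_)
  simp only [compat_mul, compat_restrict, compat_merge, Set.forall_mem_range]
  constructor
  · rintro ⟨_, ⟨k, h1, rfl, -⟩, h2⟩ i
    rw [h1, h2]
  · intro h1
    obtain ⟨k, hk, hk'⟩ := h.exists_extension (fun i => f (c i))
    exact ⟨k, ⟨k, fun i => (hk' i).symm, rfl, hk⟩, fun i => by rw [hk', h1]⟩

/-- Each class of `link c c'` that meets the two ranges contains a point of `c'`, which keeps it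
alive. The product `pqp` is thus also a product of two projections, and `x_mul_x` lifts the
identity. It is what makes transports invisible after a merge. -/
theorem x_merge_restrict_merge (c c' : ι → X) :
    x (merge (link c c')) * x (restrict (Set.range c')) * x (merge (link c c')) =
      x (restrict (Set.range c ∪ Set.range c')) * x (merge (link c c')) := by
  have key : (merge (link c c') * restrict (Set.range c') * merge (link c c') :
      PartitionMonoid X) = restrict (Set.range c ∪ Set.range c') * merge (link c c') := by
    refine ext_compat fun f g => ?_
    simp only [compat_mul, compat_restrict, compat_merge, Set.forall_mem_range, link_le,
      Setoid.ker_def]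
    constructor
    · rintro ⟨_, ⟨_, ⟨rfl, h1⟩, h2⟩, rfl, h3⟩
      refine ⟨_, ?_, rfl, h3⟩
      rintro _ (⟨i, rfl⟩ | ⟨i, rfl⟩)
      · rw [h1, h3, h2]
      · exact h2 i
    · rintro ⟨_, h1, rfl, h2⟩
      refine ⟨_, ⟨f, ⟨rfl, fun i => ?_⟩, fun i => h1 _ (.inr ⟨i, rfl⟩)⟩, rfl, h2⟩
      rw [h1 _ (.inl ⟨i, rfl⟩), h1 _ (.inr ⟨i, rfl⟩), h2]
  have e := x_mul_x_mul_x (p := merge (link c c')) (q := restrict (Set.range c'))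
    (t := (merge (link c c')).theta (restrict (Set.range c'))) rfl
  rw [e]
  exact (x_mul_x key.symm).symm

theorem x_restrict_merge_restrict_eq (m : Setoid X) (Y : Set X) :
    x (restrict Y) * x (merge m) * x (restrict Y) = x (restrict Y) * x (merge (isolate m Y)) := by
  have key : (restrict Y * merge m * restrict Y : PartitionMonoid X) =
      restrict Y * merge (isolate m Y) := by
    refine ext_compat fun f g => ?_
    simp only [compat_mul, compat_restrict, compat_merge]
    constructor
    · rintro ⟨_, ⟨k, h1, rfl, h2⟩, h3⟩
      refine ⟨g, fun y hy => by rw [h1 y hy, h3 y hy], rfl, ?_⟩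
      rintro a b (rfl | ⟨ha, hb, hab⟩)
      · rfl
      · rw [Setoid.ker_def, ← h3 a ha, ← h3 b hb]
        exact h2 hab
    · rintro ⟨_, h1, rfl, h2⟩
      -- The middle colouring is the saturation of `f` on `Y` under `m`; it gives `f` back on `Y`
      -- because `f` is constant on the traces of the classes.
      have h4 : ∀ a ∈ Y, (∃ y ∈ Y, m y a ∧ f y) = f a := fun a ha => propext
        ⟨fun ⟨y, hy, hya, hf⟩ => by
          have := h2 (.inr ⟨hy, ha, hya⟩ : isolate m Y y a)
          rw [Setoid.ker_def] at this
          rw [h1 a ha, ← this, ← h1 y hy]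
          exact hf, fun hf => ⟨a, ha, m.refl' a, hf⟩⟩
      refine ⟨fun a => ∃ y ∈ Y, m y a ∧ f y, ⟨_, fun a ha => (h4 a ha).symm, rfl, ?_⟩,
        fun a ha => (h4 a ha).trans (h1 a ha)⟩
      exact fun a b hab => propext
        ⟨fun ⟨y, hy, hya, hf⟩ => ⟨y, hy, m.trans' hya hab, hf⟩,
          fun ⟨y, hy, hya, hf⟩ => ⟨y, hy, m.trans' hya (m.symm' hab), hf⟩⟩
  have e := x_mul_x_mul_x (p := restrict Y) (q := merge m) (t := (restrict Y).theta (merge m)) rfl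
  rw [e]
  exact (x_mul_x key.symm).symm

theorem rel_inl_inr_of_projection (p : Projections (PartitionMonoid X)) {x y : X}
    (h : p.1.rel (.inl x) (.inr y)) : p.1.rel (.inl x) (.inr x) := by
  have h1 : (star p.1).rel (.inl y) (.inr x) := p.1.rel.symm' h
  rw [p.2.isSelfAdjoint.star_eq] at h1
  rw [← p.2.isIdempotentElem.eq, mul_rel]
  exact .trans _ _ _ (.rel _ _ (.left h)) (.rel _ _ (.right h1))

theorem rel_inr_inr_of_projection (p : Projections (PartitionMonoid X)) {x y : X} :
    p.1.rel (.inr x) (.inr y) ↔ p.1.rel (.inl x) (.inl y) := by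
  conv_lhs => rw [← p.2.isSelfAdjoint.star_eq]
  rfl

/-- Every generator is a product of generators for `merge` and `restrict`. -/
theorem x_eq_merge_restrict_merge (p : Projections (PartitionMonoid X)) :
    ∃ m Y, x p = x (merge m) * x (restrict Y) * x (merge m) := by
  -- `m` is the upper kernel of `p`, and `Y` the union of the upper parts of its transversals.
  refine ⟨Setoid.comap Sum.inl p.1.rel, {y | p.1.rel (.inl y) (.inr y)},
    (x_mul_x_mul_x (ext_compat fun f g => ?_)).symm⟩
  simp only [compat_mul, compat_restrict, compat_merge]
  constructor
  · rintro ⟨g, ⟨_, ⟨rfl, h1⟩, h2⟩, rfl, h3⟩ u v huv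
    have key : ∀ a b, p.1.rel (.inl a) (.inr b) → f a = g b := by
      intro a b h
      have h4 := rel_inl_inr_of_projection p h
      exact (h2 a h4).trans (h3 ((rel_inr_inr_of_projection p).1 (p.1.rel.trans'
        (p.1.rel.symm' h4) h)))
    rcases u with u | u <;> rcases v with v | v
    · exact h1 huv
    · exact key _ _ huv
    · exact (key _ _ (p.1.rel.symm' huv)).symm
    · exact h3 ((rel_inr_inr_of_projection p).1 huv)
  · intro h
    exact ⟨g, ⟨f, ⟨rfl, fun a b hab => h _ _ hab⟩, fun a ha => h _ _ ha⟩, rfl,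
      fun a b hab => h (.inr a) (.inr b) ((rel_inr_inr_of_projection p).2 hab)⟩

end PartitionMonoid

namespace PartitionMonoid

open PG Function

variable {X ι : Type*}

/-! ### The local system of a projection -/

/-- Once `m` identifies `c` with `c'`, the transport leaves no trace: by `x_merge_restrict_merge`
its restriction can be enlarged to contain the range of `c`, where `w` absorbs it. -/
theorem mul_x_collapse {c c' : ι → X} {m : Setoid X} {w : PG (PartitionMonoid X)}
    (hw : w * x (restrict (Set.range c)) = w) (h : link c c' ≤ m) :
    w * x (merge (link c c')) * x (restrict (Set.range c')) * x (merge m) = w * x (merge m) := by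
  calc w * x (merge (link c c')) * x (restrict (Set.range c')) * x (merge m)
      = w * (x (merge (link c c')) * x (restrict (Set.range c')) * x (merge (link c c'))) *
          x (merge m) := by
        conv_lhs => rw [← x_merge_mul_x_merge_of_le h]
        simp only [mul_assoc]
    _ = w * (x (restrict (Set.range c)) * x (restrict (Set.range c ∪ Set.range c'))) *
          (x (merge (link c c')) * x (merge m)) := by
        rw [x_merge_restrict_merge]
        conv_lhs => rw [← hw]
        simp only [mul_assoc]
    _ = w * x (merge m) := by
        rw [x_restrict_mul_x_restrict Set.subset_union_left, hw, x_merge_mul_x_merge_of_le h]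

theorem mul_x_recover {c : ι → X} {m : Setoid X} {w : PG (PartitionMonoid X)}
    (hw : w * x (restrict (Set.range c)) = w) (h : Separates m c) :
    w * x (merge m) * x (restrict (Set.range c)) = w := by
  calc w * x (merge m) * x (restrict (Set.range c))
      = w * (x (restrict (Set.range c)) * x (merge m) * x (restrict (Set.range c))) := by
        conv_lhs => rw [← hw]
        simp only [mul_assoc]
    _ = w := by rw [x_restrict_merge_restrict h, hw]

/-- The merge is cancelled by restricting again to the separated points; coherence of transports is
tested in this way. -/
theorem eq_of_mul_x_merge_eq {c : ι → X} {m : Setoid X} {w w' : PG (PartitionMonoid X)}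
    (hw : w * x (restrict (Set.range c)) = w) (hw' : w' * x (restrict (Set.range c)) = w')
    (h : Separates m c) (e : w * x (merge m) = w' * x (merge m)) : w = w' := by
  rw [← mul_x_recover hw h, e, mul_x_recover hw' h]

/-- The existence of `m` ensures that `link c c'` does not fuse two transversals. -/
theorem connect_mul_link_mul_restrict {m₀ m : Setoid X} {c₀ c c' : ι → X} (hm : Separates m c)
    (h : link c c' ≤ m) :
    connect m₀ c₀ c ⊥ * (merge (link c c')).1 * (restrict (Set.range c')).1 =
      connect m₀ c₀ c' ⊥ := by
  refine ext_compat fun f g => ?_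
  simp only [compat_mul, compat_restrict, compat_merge, compat_connect, Set.forall_mem_range]
  constructor
  · rintro ⟨_, ⟨k, ⟨h1, -, h2⟩, rfl, h3⟩, h4⟩
    refine ⟨h1, bot_le, fun i => ?_⟩
    rw [h2, ← h4]
    exact link_le.1 h3 i
  · rintro ⟨h1, -, h2⟩
    obtain ⟨k, hk, hk'⟩ := hm.exists_extension fun i => g (c' i)
    refine ⟨k, ⟨k, ⟨h1, bot_le, fun i => by rw [hk', h2]⟩, rfl, h.trans hk⟩, fun i => ?_⟩
    rw [← hk' i]
    exact (hk (link_le.1 h i)).symm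

theorem connect_mul_merge (m₀ m : Setoid X) (c₀ c : ι → X) :
    connect m₀ c₀ c ⊥ * (merge m).1 = connect m₀ c₀ c m := by
  refine ext_compat fun f g => ?_
  simp only [compat_mul, compat_merge, compat_connect]
  constructor
  · rintro ⟨_, ⟨h1, -, h2⟩, rfl, h3⟩
    exact ⟨h1, h3, h2⟩
  · rintro ⟨h1, h2, h3⟩
    exact ⟨g, ⟨h1, bot_le, h3⟩, rfl, h2⟩

/-- Equal points of the two configurations have the same index. -/
def Coherent (c c' : ι → X) : Prop := ∀ i j, c i = c' j → i = j

theorem Coherent.symm {c c' : ι → X} (h : Coherent c c') : Coherent c' c :=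
  fun i j hij => (h j i hij.symm).symm

theorem coherent_self {c : ι → X} (h : Injective c) : Coherent c c := fun _ _ hij => h hij

theorem coherent_of_agreeOff {r : ℕ} {i : Fin r} {c c' : Fin r → X} (hc : Injective c)
    (hc' : Injective c') (h : AgreeOff i c c') : Coherent c c' := by
  intro j k hjk
  by_cases hk : k = i
  · by_cases hj : j = i
    · rw [hj, hk]
    · exact hc' ((h j hj).symm.trans hjk)
  · exact hc (hjk.trans (h k hk).symm)

/-- Needed for the diagonals of a square: each coordinate of the far corner is shared with one of
its neighbours. -/
theorem Coherent.of_agreeOff {r : ℕ} {i j : Fin r} {c c₁ c₂ c' : Fin r → X} (hij : i ≠ j)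
    (h₁ : Coherent c c₁) (h₂ : Coherent c c₂) (h₁' : AgreeOff i c₁ c') (h₂' : AgreeOff j c₂ c') :
    Coherent c c' := by
  intro k l hkl
  by_cases hl : l = i
  · exact h₂ k l (hkl.trans (h₂' l (hl ▸ hij)).symm)
  · exact h₁ k l (hkl.trans (h₁' l hl).symm)

/-- Label a position by the set of indices at which configurations in `C` use it. By coherence the
label of `c i` is `{i}`, and `m` is equality of labels. -/
theorem exists_separates {C : Set (ι → X)} (hC : ∀ c ∈ C, ∀ c' ∈ C, Coherent c c') :
    ∃ m : Setoid X, (∀ c ∈ C, ∀ c' ∈ C, link c c' ≤ m) ∧ ∀ c ∈ C, Separates m c := by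
  let l : X → Set ι := fun y => {i | ∃ c ∈ C, c i = y}
  have hl : ∀ c ∈ C, ∀ i, l (c i) = {i} := by
    intro c hc i
    ext j
    simp only [l, Set.mem_ofPred_eq, Set.mem_singleton_iff]
    exact ⟨fun ⟨c', hc', h⟩ => hC c' hc' c hc _ _ h, fun h => ⟨c, hc, by rw [h]⟩⟩
  refine ⟨Setoid.ker l, fun c hc c' hc' => link_le.2 fun i => ?_, fun c hc i j hij => ?_⟩
  · rw [Setoid.ker_def, hl c hc, hl c' hc']
  · rw [Setoid.ker_def, hl c hc, hl c hc] at hij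
    exact Set.singleton_injective hij

theorem exists_separates_of_agreeOff {r : ℕ} {i : Fin r} {c c' : Fin r → X} (hc : Injective c)
    (hc' : Injective c') (h : AgreeOff i c c') :
    ∃ m : Setoid X, link c c' ≤ m ∧ Separates m c ∧ Separates m c' := by
  have h0 := coherent_of_agreeOff hc hc' h
  obtain ⟨m, hm, hm'⟩ := exists_separates (C := {c, c'}) (by
    rintro a (rfl | rfl) b (rfl | rfl)
    exacts [coherent_self hc, h0, h0.symm, coherent_self hc'])
  exact ⟨m, hm _ (by simp) _ (by simp), hm' _ (by simp), hm' _ (by simp)⟩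

/-- The local system of the elements of `PG` that are mapped to `connect m₀ c₀ c ⊥`. -/
def localSystem {r : ℕ} (m₀ : Setoid X) (c₀ : Fin r → X) :
    LocalSystem r X (PG (PartitionMonoid X)) where
  fib c := {w | w * x (restrict (Set.range c)) = w ∧
    toSemigroup (PartitionMonoid X) w = connect m₀ c₀ c ⊥}
  tr c c' w := w * x (merge (link c c')) * x (restrict (Set.range c'))
  mem := by
    rintro i c c' w hc hc' h ⟨-, hw'⟩
    obtain ⟨m, hm, hs, -⟩ := exists_separates_of_agreeOff hc hc' h
    refine ⟨by rw [mul_assoc, x_mul_self], ?_⟩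
    rw [map_mul, map_mul, hw']
    exact connect_mul_link_mul_restrict hs hm
  refl := by
    rintro c w hc ⟨hw, -⟩
    obtain ⟨m, hm, hm'⟩ := exists_separates (C := {c}) (by
      rintro a rfl b rfl
      exact coherent_self hc)
    exact eq_of_mul_x_merge_eq (by rw [mul_assoc, x_mul_self]) hw (hm' c rfl)
      (mul_x_collapse hw (hm c rfl c rfl))
  triangle := by
    rintro i c c' c'' w hc hc' hc'' h h' ⟨hw, -⟩
    have h1 := coherent_of_agreeOff hc hc' h
    have h2 := coherent_of_agreeOff hc' hc'' h'
    have h3 := coherent_of_agreeOff hc hc'' (h.trans h')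
    obtain ⟨m, hm, hm'⟩ := exists_separates (C := {c, c', c''}) (by
      rintro a (rfl | rfl | rfl) b (rfl | rfl | rfl)
      exacts [coherent_self hc, h1, h3, h1.symm, coherent_self hc', h2, h3.symm, h2.symm,
        coherent_self hc''])
    refine eq_of_mul_x_merge_eq (c := c'') (by rw [mul_assoc, x_mul_self])
      (by rw [mul_assoc, x_mul_self]) (hm' c'' (by simp)) ?_
    rw [mul_x_collapse (by rw [mul_assoc, x_mul_self]) (hm _ (by simp) _ (by simp)),
      mul_x_collapse hw (hm _ (by simp) _ (by simp)),
      mul_x_collapse hw (hm _ (by simp) _ (by simp))]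
  square := by
    rintro i j c₁ c₂ c₃ c₄ w hij hc₁ hc₂ hc₃ hc₄ h₁₂ h₂₃ h₁₄ h₄₃ ⟨hw, -⟩
    have k₁₂ := coherent_of_agreeOff hc₁ hc₂ h₁₂
    have k₂₃ := coherent_of_agreeOff hc₂ hc₃ h₂₃
    have k₁₄ := coherent_of_agreeOff hc₁ hc₄ h₁₄
    have k₄₃ := coherent_of_agreeOff hc₄ hc₃ h₄₃
    -- Opposite corners are not adjacent, but one `m` has to serve all four.
    have k₁₃ := k₁₂.of_agreeOff hij.symm k₁₄ h₂₃ h₄₃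
    have k₂₄ := k₂₃.of_agreeOff hij k₁₂.symm h₄₃.symm h₁₄
    obtain ⟨m, hm, hm'⟩ := exists_separates (C := {c₁, c₂, c₃, c₄}) (by
      rintro a (rfl | rfl | rfl | rfl) b (rfl | rfl | rfl | rfl)
      exacts [coherent_self hc₁, k₁₂, k₁₃, k₁₄, k₁₂.symm, coherent_self hc₂, k₂₃, k₂₄,
        k₁₃.symm, k₂₃.symm, coherent_self hc₃, k₄₃.symm, k₁₄.symm, k₂₄.symm, k₄₃,
        coherent_self hc₄])
    refine eq_of_mul_x_merge_eq (c := c₃) (by rw [mul_assoc, x_mul_self])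
      (by rw [mul_assoc, x_mul_self]) (hm' c₃ (by simp)) ?_
    rw [mul_x_collapse (by rw [mul_assoc, x_mul_self]) (hm _ (by simp) _ (by simp)),
      mul_x_collapse hw (hm _ (by simp) _ (by simp)),
      mul_x_collapse (by rw [mul_assoc, x_mul_self]) (hm _ (by simp) _ (by simp)),
      mul_x_collapse hw (hm _ (by simp) _ (by simp))]

/-! ### Frames and coherent lifts -/

/-- `q` is the projection with kernel `m₀` whose transversals are the classes of the points
`c₀ i`, which are in different classes. -/
structure IsFrame (q : Projections (PartitionMonoid X)) (m₀ : Setoid X) (c₀ : ι → X) : Prop where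
  eq : q.1 = connect m₀ c₀ c₀ m₀
  sep : Separates m₀ c₀

theorem IsFrame.compat {q : Projections (PartitionMonoid X)} {m₀ : Setoid X} {c₀ : ι → X}
    (hq : IsFrame q m₀ c₀) {f g : X → Prop} :
    Compat q.1 f g ↔ m₀ ≤ Setoid.ker f ∧ m₀ ≤ Setoid.ker g ∧ ∀ i, f (c₀ i) = g (c₀ i) := by
  rw [hq.eq, compat_connect]

theorem IsFrame.x_merge_restrict_merge {q : Projections (PartitionMonoid X)} {m₀ : Setoid X}
    {c₀ : ι → X} (hq : IsFrame q m₀ c₀) :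
    x (merge m₀) * x (restrict (Set.range c₀)) * x (merge m₀) = x q := by
  refine x_mul_x_mul_x (ext_compat fun f g => ?_)
  simp only [compat_mul, compat_restrict, compat_merge, hq.compat, Set.forall_mem_range]
  constructor
  · rintro ⟨_, ⟨_, ⟨rfl, h1⟩, h2⟩, rfl, h3⟩
    exact ⟨h1, h3, h2⟩
  · rintro ⟨h1, h2, h3⟩
    exact ⟨g, ⟨f, ⟨rfl, h1⟩, h3⟩, rfl, h2⟩

/-- A coherent choice of lifts to `PG` of the elements `connect m₀ c₀ c ⊥`. -/
structure IsTransport (q : Projections (PartitionMonoid X)) (m₀ : Setoid X) (c₀ : ι → X)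
    (s : (ι → X) → PG (PartitionMonoid X)) : Prop extends IsFrame q m₀ c₀ where
  base : s c₀ * x (merge m₀) = x q
  mul_restrict : ∀ c, Injective c → s c * x (restrict (Set.range c)) = s c
  map : ∀ c, Injective c → toSemigroup (PartitionMonoid X) (s c) = connect m₀ c₀ c ⊥
  indep : ∀ {m c c'}, Separates m c → (∀ i, m (c i) (c' i)) →
    s c * x (merge m) = s c' * x (merge m)

theorem IsFrame.exists_isTransport [Fintype X] {r : ℕ} (hX : r + 2 ≤ Fintype.card X)
    {q : Projections (PartitionMonoid X)} {m₀ : Setoid X} {c₀ : Fin r → X}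
    (hq : IsFrame q m₀ c₀) : ∃ s, IsTransport q m₀ c₀ s := by
  classical
  have hw₀ : x q * x (restrict (Set.range c₀)) ∈ (localSystem m₀ c₀).fib c₀ := by
    refine ⟨by rw [mul_assoc, x_mul_self], ?_⟩
    rw [map_mul, toSemigroup_x, toSemigroup_x]
    refine ext_compat fun f g => ?_
    simp only [compat_mul, compat_restrict, hq.compat, Set.forall_mem_range, compat_connect]
    constructor
    · rintro ⟨k, ⟨h1, h2, h3⟩, h4⟩
      exact ⟨h1, bot_le, fun i => (h3 i).trans (h4 i)⟩
    · rintro ⟨h1, -, h3⟩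
      exact ⟨f, ⟨h1, h1, fun _ => rfl⟩, h3⟩
  obtain ⟨s, hs₀, hs, hstep⟩ := (localSystem m₀ c₀).exists_section hX hq.sep.injective hw₀
  refine ⟨s, hq, ?_, fun c hc => (hs c hc).1, fun c hc => (hs c hc).2, ?_⟩
  · have e : x q * x (merge m₀) = x q := by
      rw [← hq.x_merge_restrict_merge, mul_assoc _ (x (merge m₀)), x_mul_self]
    calc s c₀ * x (merge m₀)
        = x q * (x (merge m₀) * x (restrict (Set.range c₀)) * x (merge m₀)) := by
          rw [hs₀]
          conv_lhs => rw [← e]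
          simp only [mul_assoc]
      _ = x q := by rw [hq.x_merge_restrict_merge, x_mul_self]
  · intro m c c' hm hcc'
    -- Pass from `c` to `c'` one coordinate at a time: every intermediate configuration is still
    -- separated by `m`, hence injective, and each step collapses under `x (merge m)`.
    have hsep : ∀ A : Finset (Fin r), Separates m (A.piecewise c' c) := fun A =>
      hm.congr fun i => by
        by_cases h : i ∈ A
        · simpa [h] using hcc' i
        · simp [h]
    have key : ∀ A : Finset (Fin r), s (A.piecewise c' c) * x (merge m) = s c * x (merge m) := by
      intro A
      induction A using Finset.induction_on with
      | empty => simp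
      | insert i A hi ih =>
        have hag : AgreeOff i (A.piecewise c' c) ((insert i A).piecewise c' c) := by
          intro j hj
          rw [Finset.piecewise_insert, Function.update_of_ne hj]
        have hinj := (hsep A).injective
        rw [← hstep i _ _ hinj (hsep (insert i A)).injective hag, ← ih]
        refine mul_x_collapse (hs _ hinj).1 (link_le.2 fun j => ?_)
        by_cases hj : j = i
        · subst hj
          simpa [hi] using hcc' j
        · rw [hag j hj]
    simpa using (key Finset.univ).symm

/-! ### Normal forms above an `R`-class -/

namespace IsTransport

variable {q : Projections (PartitionMonoid X)} {m₀ : Setoid X} {c₀ : ι → X}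
  {s : (ι → X) → PG (PartitionMonoid X)}

theorem map_mul_merge (hs : IsTransport q m₀ c₀ s) {c : ι → X} (hc : Injective c) (m : Setoid X) :
    toSemigroup (PartitionMonoid X) (s c * x (merge m)) = connect m₀ c₀ c m := by
  rw [map_mul, hs.map c hc, toSemigroup_x, connect_mul_merge]

/-- The elements of the form `s c * x (merge m)`, with the points `c i` in different classes. -/
def Rep (s : (ι → X) → PG (PartitionMonoid X)) (w : PG (PartitionMonoid X)) : Prop :=
  ∃ c m, Separates m c ∧ w = s c * x (merge m)

/-- If the larger equivalence joined `c i` and `c j`, the transversals `i` and `j` would be fused,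
and no right factor `b` could separate them to recover `q`. -/
theorem rep_mul_merge (hs : IsTransport q m₀ c₀ s) {w : PG (PartitionMonoid X)} {m' : Setoid X}
    (hw : Rep s w) (hb : ∃ b, toSemigroup (PartitionMonoid X) (w * x (merge m')) * b = q.1) :
    Rep s (w * x (merge m')) := by
  obtain ⟨c, m, hm, rfl⟩ := hw
  obtain ⟨b, hb⟩ := hb
  rw [mul_assoc, x_merge_mul_x_merge] at hb ⊢
  rw [hs.map_mul_merge hm.injective] at hb
  refine ⟨c, m ⊔ m', fun i j hij => ?_, rfl⟩
  obtain ⟨f, hf, hf'⟩ := hs.sep.exists_extension fun k => k = i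
  have h : Compat q.1 f f := hs.compat.2 ⟨hf, hf, fun _ => rfl⟩
  rw [← hb, compat_mul] at h
  obtain ⟨k, h1, -⟩ := h
  obtain ⟨-, h2, h3⟩ := compat_connect.1 h1
  have h4 : (i = i) = (j = i) := by
    rw [← hf' i, ← hf' j, h3, h3]
    exact h2 hij
  exact (h4 ▸ rfl : j = i).symm

/-- Since `q` can be recovered, no transversal is cut off, so the class of each `c i` meets `Y`. By
`indep` the points may be slid into `Y`, where the restriction only shrinks `m`. -/
theorem rep_mul_restrict (hs : IsTransport q m₀ c₀ s) {w : PG (PartitionMonoid X)} {Y : Set X}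
    (hw : Rep s w) (hb : ∃ b, toSemigroup (PartitionMonoid X) (w * x (restrict Y)) * b = q.1) :
    Rep s (w * x (restrict Y)) := by
  obtain ⟨c, m, hm, rfl⟩ := hw
  obtain ⟨b, hb⟩ := hb
  have hex : ∀ i, ∃ y ∈ Y, m (c i) y := by
    intro i
    by_contra! hno
    obtain ⟨f, hf, hf'⟩ := hs.sep.exists_extension fun k => m (c i) (c k)
    have h : Compat q.1 f (fun _ => False) := by
      rw [← hb, map_mul, hs.map_mul_merge hm.injective, toSemigroup_x, compat_mul]
      refine ⟨fun _ => False, (compat_mul _ _ _ _).2 ⟨fun y => m (c i) y,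
        compat_connect.2 ⟨hf, le_ker_class m _, hf'⟩,
        compat_restrict.2 fun y hy => eq_false (hno y hy)⟩, ?_⟩
      rintro (u | u) (v | v) - <;> rfl
    have h1 := (hs.compat.1 h).2.2 i
    rw [hf' i] at h1
    exact h1 ▸ m.refl' (c i)
  choose c' hY hc' using hex
  have hm' : Separates m c' := hm.congr hc'
  have hsub : Set.range c' ⊆ Y := by
    rintro _ ⟨i, rfl⟩
    exact hY i
  have e : s c' * x (restrict Y) = s c' := by
    conv_lhs => rw [← hs.mul_restrict c' hm'.injective]
    rw [mul_assoc, x_restrict_mul_x_restrict hsub, hs.mul_restrict c' hm'.injective]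
  refine ⟨c', isolate m Y, fun i j hij => hm' i j (isolate_le m Y hij), ?_⟩
  calc s c * x (merge m) * x (restrict Y)
      = s c' * (x (restrict Y) * x (merge m) * x (restrict Y)) := by
        rw [hs.indep hm hc']
        conv_lhs => rw [← e]
        simp only [mul_assoc]
    _ = s c' * x (merge (isolate m Y)) := by
        rw [x_restrict_merge_restrict_eq, ← mul_assoc, e]

/-- Every prefix of a product from which `q` can be recovered has the same property, so the normal
form survives letter by letter. -/
theorem rep_mul (hs : IsTransport q m₀ c₀ s) {u : PG (PartitionMonoid X)} (hu : Rep s u)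
    (v : PG (PartitionMonoid X)) (hb : ∃ b, toSemigroup (PartitionMonoid X) (u * v) * b = q.1) :
    Rep s (u * v) := by
  have step : ∀ {y z : PG (PartitionMonoid X)},
      (∃ b, toSemigroup (PartitionMonoid X) (y * z) * b = q.1) →
        ∃ b, toSemigroup (PartitionMonoid X) y * b = q.1 := by
    rintro y z ⟨b, hb⟩
    exact ⟨toSemigroup (PartitionMonoid X) z * b, by rw [← mul_assoc, ← map_mul, hb]⟩
  induction v using PG.induction_on generalizing u with
  | hx p =>
    obtain ⟨m, Y, e⟩ := x_eq_merge_restrict_merge p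
    rw [e, ← mul_assoc, ← mul_assoc] at hb ⊢
    exact hs.rep_mul_merge (hs.rep_mul_restrict (hs.rep_mul_merge hu (step (step hb))) (step hb)) hb
  | hmul v₁ v₂ h₁ h₂ =>
    rw [← mul_assoc] at hb ⊢
    exact h₂ (h₁ hu (step hb)) hb

theorem rep_of_mul_eq (hs : IsTransport q m₀ c₀ s) {w : PG (PartitionMonoid X)}
    (h : q.1 * toSemigroup (PartitionMonoid X) w = toSemigroup (PartitionMonoid X) w)
    (hb : ∃ b, toSemigroup (PartitionMonoid X) w * b = q.1) : Rep s w := by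
  have e := x_mul_of_mul_eq h
  rw [← e] at hb ⊢
  exact hs.rep_mul ⟨c₀, m₀, hs.sep, hs.base.symm⟩ w hb

end IsTransport

/-- Because `m₀` separates `c₀`, every lower colouring constant on `m'` extends to a compatible
pair; so the lower kernel can be read off. -/
theorem le_of_connect_eq {m₀ m m' : Setoid X} {c₀ c c' : ι → X} (hm₀ : Separates m₀ c₀)
    (h : connect m₀ c₀ c m = connect m₀ c₀ c' m') : m ≤ m' := by
  refine setoid_le_of_ker fun g hg => ?_
  obtain ⟨f, hf, hf'⟩ := hm₀.exists_extension fun i => g (c' i)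
  have h1 : Compat (connect m₀ c₀ c' m') f g := compat_connect.2 ⟨hf, hg, hf'⟩
  rw [← h] at h1
  exact (compat_connect.1 h1).2.1

theorem rel_of_connect_eq {m₀ m : Setoid X} {c₀ c c' : ι → X} (hm₀ : Separates m₀ c₀)
    (h : connect m₀ c₀ c m = connect m₀ c₀ c' m) (i : ι) : m (c i) (c' i) := by
  obtain ⟨f, hf, hf'⟩ := hm₀.exists_extension fun k => m (c i) (c k)
  have h1 : Compat (connect m₀ c₀ c m) f (fun y => m (c i) y) :=
    compat_connect.2 ⟨hf, le_ker_class m _, hf'⟩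
  rw [h] at h1
  have h2 := (compat_connect.1 h1).2.2 i
  rw [hf' i] at h2
  exact h2 ▸ m.refl' (c i)

/-- The canonical map `PG → PartitionMonoid X` is injective above the `R`-class of a projection
with at most `card X - 2` transversals. -/
theorem IsTransport.injective {q : Projections (PartitionMonoid X)} {m₀ : Setoid X} {c₀ : ι → X}
    {s : (ι → X) → PG (PartitionMonoid X)} (hs : IsTransport q m₀ c₀ s)
    {w w' : PG (PartitionMonoid X)}
    (h : q.1 * toSemigroup (PartitionMonoid X) w = toSemigroup (PartitionMonoid X) w)
    (hb : ∃ b, toSemigroup (PartitionMonoid X) w * b = q.1)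
    (e : toSemigroup (PartitionMonoid X) w = toSemigroup (PartitionMonoid X) w') : w = w' := by
  obtain ⟨c, m, hm, rfl⟩ := hs.rep_of_mul_eq h hb
  rw [e] at h hb
  obtain ⟨c', m', hm', rfl⟩ := hs.rep_of_mul_eq h hb
  rw [hs.map_mul_merge hm.injective, hs.map_mul_merge hm'.injective] at e
  obtain rfl := le_antisymm (le_of_connect_eq hs.sep e) (le_of_connect_eq hs.sep e.symm)
  exact hs.indep hm (rel_of_connect_eq hs.sep e)

/-! ### The maximal subgroups -/

/-- Transversals compose from left to right, so the order of the permutations is reversed; the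
inverse in `ofPerm` compensates for this. -/
theorem connect_mul_connect (m₀ : Setoid X) {c₀ : ι → X} (hm₀ : Separates m₀ c₀)
    (σ τ : Equiv.Perm ι) :
    connect m₀ c₀ (c₀ ∘ σ) m₀ * connect m₀ c₀ (c₀ ∘ τ) m₀ = connect m₀ c₀ (c₀ ∘ (τ * σ)) m₀ := by
  refine ext_compat fun f g => ?_
  simp only [compat_mul, compat_connect, comp_apply, Equiv.Perm.coe_mul]
  constructor
  · rintro ⟨k, ⟨h1, -, h2⟩, -, h4, h5⟩
    exact ⟨h1, h4, fun i => by rw [h2, h5]⟩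
  · rintro ⟨h1, h2, h3⟩
    obtain ⟨k, hk, hk'⟩ := hm₀.exists_extension fun i => f (c₀ (σ.symm i))
    refine ⟨k, ⟨h1, hk, fun i => by simp [hk']⟩, hk, h2, fun i => ?_⟩
    rw [hk', h3]
    simp

namespace IsTransport

variable {q : Projections (PartitionMonoid X)} {m₀ : Setoid X} {c₀ : ι → X}
  {s : (ι → X) → PG (PartitionMonoid X)}

/-- The lift of a permutation of the transversals. -/
def ofPerm (s : (ι → X) → PG (PartitionMonoid X)) (m₀ : Setoid X) (c₀ : ι → X)
    (σ : Equiv.Perm ι) : PG (PartitionMonoid X) :=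
  s (c₀ ∘ (σ⁻¹ : Equiv.Perm ι)) * x (merge m₀)

theorem map_ofPerm (hs : IsTransport q m₀ c₀ s) (σ : Equiv.Perm ι) :
    toSemigroup (PartitionMonoid X) (ofPerm s m₀ c₀ σ) =
      connect m₀ c₀ (c₀ ∘ (σ⁻¹ : Equiv.Perm ι)) m₀ :=
  hs.map_mul_merge (hs.sep.injective.comp (Equiv.injective _)) m₀

theorem ofPerm_one (hs : IsTransport q m₀ c₀ s) : ofPerm s m₀ c₀ 1 = x q := by
  simpa [ofPerm] using hs.base

theorem proj_eq (hs : IsTransport q m₀ c₀ s) :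
    q.1 = connect m₀ c₀ (c₀ ∘ (1 : Equiv.Perm ι)) m₀ := hs.eq

theorem ofPerm_mul (hs : IsTransport q m₀ c₀ s) (σ τ : Equiv.Perm ι) :
    ofPerm s m₀ c₀ (σ * τ) = ofPerm s m₀ c₀ σ * ofPerm s m₀ c₀ τ := by
  refine hs.injective ?_ ⟨connect m₀ c₀ (c₀ ∘ (σ * τ : Equiv.Perm ι)) m₀, ?_⟩ ?_
  · rw [hs.map_ofPerm, hs.proj_eq, connect_mul_connect m₀ hs.sep, mul_one]
  · rw [hs.map_ofPerm, hs.proj_eq, connect_mul_connect m₀ hs.sep, mul_inv_cancel]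
  · rw [map_mul, hs.map_ofPerm, hs.map_ofPerm, hs.map_ofPerm, connect_mul_connect m₀ hs.sep,
      mul_inv_rev]

theorem ofPerm_mem (hs : IsTransport q m₀ c₀ s) (σ : Equiv.Perm ι) :
    ofPerm s m₀ c₀ σ ∈ maximalSubgroup (x q) (isIdempotentElem_x q) := by
  rw [mem_maximalSubgroup_iff, ← hs.ofPerm_one]
  refine ⟨?_, ?_, ⟨ofPerm s m₀ c₀ σ⁻¹, ?_⟩, ofPerm s m₀ c₀ σ⁻¹, ?_⟩ <;>
    rw [← hs.ofPerm_mul] <;> simp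

theorem ofPerm_injective (hs : IsTransport q m₀ c₀ s) : Injective (ofPerm s m₀ c₀) := by
  intro σ τ h
  have e := congrArg (toSemigroup (PartitionMonoid X)) h
  rw [hs.map_ofPerm, hs.map_ofPerm] at e
  exact inv_injective (Equiv.ext fun i => hs.sep _ _ (rel_of_connect_eq hs.sep e i))

/-- Write `w` in normal form. Being fixed by `q` on the right gives `m₀ ≤ m`, recovering `q` by a
left factor gives `m ≤ m₀`, and then each `c i` lies in the class of some `c₀ j`. -/
theorem exists_ofPerm_eq [Finite ι] (hs : IsTransport q m₀ c₀ s) {w : PG (PartitionMonoid X)}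
    (hw : w ∈ maximalSubgroup (x q) (isIdempotentElem_x q)) : ∃ σ, ofPerm s m₀ c₀ σ = w := by
  obtain ⟨h1, h2, ⟨b, hb⟩, d, hd⟩ := mem_maximalSubgroup_iff.1 hw
  replace h1 := congrArg (toSemigroup (PartitionMonoid X)) h1
  replace h2 := congrArg (toSemigroup (PartitionMonoid X)) h2
  replace hb := congrArg (toSemigroup (PartitionMonoid X)) hb
  replace hd := congrArg (toSemigroup (PartitionMonoid X)) hd
  rw [map_mul, toSemigroup_x] at h1 h2 hb hd
  obtain ⟨c, m, hm, rfl⟩ := hs.rep_of_mul_eq h1 ⟨_, hb⟩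
  rw [hs.map_mul_merge hm.injective] at h2 hd
  have hle : m₀ ≤ m := setoid_le_of_ker fun g hg => by
    obtain ⟨f, hf, hf'⟩ := hs.sep.exists_extension fun i => g (c i)
    have h : Compat (connect m₀ c₀ c m) f g := compat_connect.2 ⟨hf, hg, hf'⟩
    rw [← h2, compat_mul] at h
    obtain ⟨k, -, hk⟩ := h
    exact (hs.compat.1 hk).2.1
  have hge : m ≤ m₀ := setoid_le_of_ker fun g hg => by
    have h : Compat q.1 g g := hs.compat.2 ⟨hg, hg, fun _ => rfl⟩
    rw [← hd, compat_mul] at h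
    obtain ⟨k, -, hk⟩ := h
    exact (compat_connect.1 hk).2.1
  obtain rfl := le_antisymm hle hge
  have hex : ∀ i, ∃ j, m₀ (c i) (c₀ j) := by
    intro i
    by_contra! hno
    obtain ⟨f, hf, hf'⟩ := hs.sep.exists_extension fun k => m₀ (c i) (c k)
    have h : Compat (connect m₀ c₀ c m₀) f (fun _ => False) := by
      rw [← h2, compat_mul]
      exact ⟨fun y => m₀ (c i) y, compat_connect.2 ⟨hf, le_ker_class m₀ _, hf'⟩,
        hs.compat.2 ⟨le_ker_class m₀ _, fun _ _ _ => rfl, fun j => eq_false (hno j)⟩⟩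
    have h3 := (compat_connect.1 h).2.2 i
    rw [hf' i] at h3
    exact h3 ▸ m₀.refl' (c i)
  choose σ hσ using hex
  have hinj : Injective σ := fun i j hij =>
    hm i j (m₀.trans' (hσ i) (m₀.symm' (hij ▸ hσ j)))
  refine ⟨(Equiv.ofBijective σ (Finite.injective_iff_bijective.1 hinj))⁻¹, ?_⟩
  rw [ofPerm, inv_inv]
  exact (hs.indep hm hσ).symm

theorem nonempty_mulEquiv [Finite ι] (hs : IsTransport q m₀ c₀ s) :
    Nonempty (maximalSubgroup (x q) (isIdempotentElem_x q) ≃* Equiv.Perm ι) := by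
  let φ : Equiv.Perm ι →ₙ* maximalSubgroup (x q) (isIdempotentElem_x q) :=
    { toFun := fun σ => ⟨ofPerm s m₀ c₀ σ, hs.ofPerm_mem σ⟩
      map_mul' := fun σ τ => Subtype.ext (hs.ofPerm_mul σ τ) }
  refine ⟨(MulEquiv.ofBijective φ ⟨fun σ τ h => ?_, fun w => ?_⟩).symm⟩
  · exact hs.ofPerm_injective (Subtype.ext_iff.1 h)
  · obtain ⟨σ, hσ⟩ := hs.exists_ofPerm_eq w.2
    exact ⟨σ, Subtype.ext hσ⟩

end IsTransport

/-! ### Frames from the rank -/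

/-- `a * star a` has the upper kernel of `a`, and its transversals double the upper parts of those
of `a`; `c₀` picks a point in each. -/
theorem exists_isFrame [Finite X] {r : ℕ} (a : PartitionMonoid X) (ha : a.rank = r) :
    ∃ (m₀ : Setoid X) (c₀ : Fin r → X), IsFrame (leftProj a) m₀ c₀ := by
  let T : Set (Set (X ⊕ X)) :=
    {B ∈ a.rel.classes | (∃ x, Sum.inl x ∈ B) ∧ ∃ y, Sum.inr y ∈ B}
  have hT : Nat.card T = r := ha
  let φ : Fin r ≃ T := (Finite.equivFinOfCardEq hT).symm
  have hu : ∀ i, ∃ u, Sum.inl u ∈ (φ i).1 := fun i => (φ i).2.2.1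
  have hl : ∀ i, ∃ y, Sum.inr y ∈ (φ i).1 := fun i => (φ i).2.2.2
  choose c hc using hu
  choose d hd using hl
  have hclass : ∀ i v, v ∈ (φ i).1 ↔ a.rel (.inl (c i)) v := by
    intro i v
    obtain ⟨w, hw⟩ := (φ i).2.1
    have h1 : a.rel (.inl (c i)) w := by
      have := hc i
      rwa [hw] at this
    rw [hw]
    exact ⟨fun h => a.rel.trans' h1 (a.rel.symm' h), fun h => a.rel.trans' (a.rel.symm' h) h1⟩
  have hsep : ∀ i j, a.rel (.inl (c i)) (.inl (c j)) → i = j := by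
    intro i j h
    refine φ.injective (Subtype.ext (Set.ext fun v => ?_))
    rw [hclass, hclass]
    exact ⟨a.rel.trans' (a.rel.symm' h), a.rel.trans' h⟩
  have hcov : ∀ u y, a.rel (.inl u) (.inr y) → ∃ i, a.rel (.inl (c i)) (.inl u) := by
    intro u y h
    let B : T := ⟨{v | a.rel v (.inl u)}, ⟨.inl u, rfl⟩, ⟨u, a.rel.refl' _⟩, y, a.rel.symm' h⟩
    refine ⟨φ.symm B, (hclass _ _).1 ?_⟩
    rw [Equiv.apply_symm_apply]
    exact a.rel.refl' _
  refine ⟨Setoid.comap Sum.inl a.rel, c, ext_compat fun f g => ?_, hsep⟩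
  rw [compat_connect]
  change Compat (a * star a) f g ↔ _
  simp only [compat_mul, compat_star]
  constructor
  · rintro ⟨k, h1, h2⟩
    refine ⟨fun u v h => h1 _ _ h, fun u v h => h2 _ _ h, fun i => ?_⟩
    have h3 := (hclass i _).1 (hd i)
    exact (h1 _ _ h3).trans (h2 _ _ h3).symm
  · rintro ⟨h1, h2, h3⟩
    -- The middle colouring gives each lower point the colour of its transversal, and `False` to
    -- points on none. It uses only the values at the `c i`, so `f` and `g` share it.
    have key : ∀ f : X → Prop, Setoid.comap Sum.inl a.rel ≤ Setoid.ker f →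
        Compat a f (fun y => ∃ i, a.rel (.inl (c i)) (.inr y) ∧ f (c i)) := by
      intro f hf
      have main : ∀ u y, a.rel (.inl u) (.inr y) →
          f u = ∃ i, a.rel (.inl (c i)) (.inr y) ∧ f (c i) := by
        intro u y h
        obtain ⟨i, hi⟩ := hcov u y h
        have e : f (c i) = f u := hf hi
        refine propext ⟨fun hu => ⟨i, a.rel.trans' hi h, e ▸ hu⟩, ?_⟩
        rintro ⟨j, hj, hfj⟩
        have : j = i := hsep _ _ (a.rel.trans' hj (a.rel.symm' (a.rel.trans' hi h)))
        rw [← e, ← this]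
        exact hfj
      rintro (u | u) (v | v) h
      · exact hf h
      · exact main _ _ h
      · exact (main _ _ (a.rel.symm' h)).symm
      · exact propext ⟨fun ⟨i, h1, h2⟩ => ⟨i, a.rel.trans' h1 h, h2⟩,
          fun ⟨i, h1, h2⟩ => ⟨i, a.rel.trans' h1 (a.rel.symm' h), h2⟩⟩
    refine ⟨_, key f h1, ?_⟩
    simp only [h3]
    exact key g h2

/-! ### Idempotents and maximal subgroups in low rank -/

theorem exists_isTransport [Fintype X] {r : ℕ} (hX : r + 2 ≤ Fintype.card X)
    {a : PartitionMonoid X} (ha : a.rank = r) :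
    ∃ (m₀ : Setoid X) (c₀ : Fin r → X) (s : _), IsTransport (leftProj a) m₀ c₀ s := by
  obtain ⟨m₀, c₀, h⟩ := exists_isFrame a ha
  obtain ⟨s, hs⟩ := h.exists_isTransport hX
  exact ⟨m₀, c₀, s, hs⟩

/-- The canonical map is injective on the elements of rank at most `card X - 2`. -/
theorem toSemigroup_injective_of_rank [Fintype X] {r : ℕ} (hX : r + 2 ≤ Fintype.card X)
    {w w' : PG (PartitionMonoid X)} (hw : (toSemigroup (PartitionMonoid X) w).rank = r)
    (h : toSemigroup (PartitionMonoid X) w = toSemigroup (PartitionMonoid X) w') : w = w' := by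
  obtain ⟨m₀, c₀, s, hs⟩ := exists_isTransport hX hw
  exact hs.injective (leftProj_mul _) ⟨_, rfl⟩ h

/-- An idempotent `e` equals `(e e*)(e* e)`, and a product of two generators of `PG` is idempotent.
-/
theorem exists_idempotent_lift {S : Type*} [Semigroup S] [RegularStarSemigroup S] {e : S}
    (he : IsIdempotentElem e) : ∃ f : PG S, IsIdempotentElem f ∧ toSemigroup S f = e := by
  refine ⟨x (leftProj e) * x (leftProj (star e)), isIdempotentElem_x_mul_x _ _, ?_⟩
  rw [map_mul, toSemigroup_x, toSemigroup_x]
  calc e * star e * (star e * star (star e)) = e * star (e * e) * e := by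
        rw [star_star, star_mul]; simp only [mul_assoc]
    _ = e := by rw [he.eq, RegularStarSemigroup.mul_star_mul_self]

theorem nonempty_maximalSubgroup_mulEquiv [Fintype X] {r : ℕ} (hX : r + 2 ≤ Fintype.card X)
    {f : PG (PartitionMonoid X)} (hf : IsIdempotentElem f)
    (hr : (toSemigroup (PartitionMonoid X) f).rank = r) :
    Nonempty (maximalSubgroup f hf ≃* Equiv.Perm (Fin r)) := by
  obtain ⟨m₀, c₀, s, hs⟩ := exists_isTransport hX hr
  set e := toSemigroup (PartitionMonoid X) f with he
  have hee : e * e = e := by rw [he, ← map_mul, hf.eq]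
  obtain ⟨ψ⟩ := hs.nonempty_mulEquiv
  -- `f` is `R`-related to `x (leftProj e)`; the second of the two equations is checked in the
  -- partition monoid and lifted by injectivity.
  have h1 : x (leftProj e) * f = f := x_leftProj_mul f
  have h2 : f * x (leftProj e) = x (leftProj e) := by
    have e1 : toSemigroup (PartitionMonoid X) (f * x (leftProj e)) = e * star e := by
      rw [map_mul, toSemigroup_x, ← he]
      change e * (e * star e) = e * star e
      rw [← mul_assoc, hee]
    refine hs.injective ?_ ⟨e * star e, ?_⟩ (e1.trans rfl) <;> rw [e1] <;>
      exact (leftProj e).2.isIdempotentElem.eq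
  exact ⟨(maximalSubgroupEquiv hf (isIdempotentElem_x _) h2 h1).trans ψ⟩

end PartitionMonoid

theorem theorem1p1 (n r : ℕ) (hr : r + 2 ≤ n) :
    (∀ p : Projections (PartitionMonoid (Fin n)), p.1.rank = r →
      Nonempty (maximalSubgroup (PG.x p) (PG.isIdempotentElem_x p) ≃* Equiv.Perm (Fin r))) ∧
    (∀ e : PartitionMonoid (Fin n), IsIdempotentElem e → e.rank = r →
      (∃! f : PG (PartitionMonoid (Fin n)),
        IsIdempotentElem f ∧ PG.toSemigroup (PartitionMonoid (Fin n)) f = e) ∧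
      ∀ (f : PG (PartitionMonoid (Fin n))) (hf : IsIdempotentElem f),
        PG.toSemigroup (PartitionMonoid (Fin n)) f = e →
          Nonempty (maximalSubgroup f hf ≃* Equiv.Perm (Fin r))) := by
  have hX : r + 2 ≤ Fintype.card (Fin n) := by rwa [Fintype.card_fin]
  refine ⟨fun p hp => PartitionMonoid.nonempty_maximalSubgroup_mulEquiv hX _ hp,
    fun e he her => ⟨?_, ?_⟩⟩
  · obtain ⟨f, hf, hfe⟩ := PartitionMonoid.exists_idempotent_lift he
    refine ⟨f, ⟨hf, hfe⟩, fun f' hf' => ?_⟩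
    exact PartitionMonoid.toSemigroup_injective_of_rank hX (hf'.2 ▸ her) (hf'.2.trans hfe.symm)
  · rintro f hf rfl
    exact PartitionMonoid.nonempty_maximalSubgroup_mulEquiv hX hf her
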